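/- Let $T$ be a rooted tree that is spherically homogeneous, with branching sequence $(d_n)_{n\ge 0}$ (each vertex of level $n$ has $d_n$ children, $1\le d_n<\infty$, and $d_n\ge 2$ for infinitely many $n$). For $G\le \operatorname{Aut}T$ and a vertex $u$, the rigid stabiliser $\mathrm{rist}_G(u)$ consists of the elements of $G$ fixing every vertex that does not have $u$ as a prefix, and $\mathrm{Rist}_G(n)$ is the product of the groups $\mathrm{rist}_G(u)$ over the vertices $u$ of level $n$. The group $G$ is a branch group if it is transitive on every level of $T$ and $\mathrm{Rist}_G(n)$ has finite index in $G$ for every $n$. A subgroup of $G$ is weakly maximal if it is maximal among the subgroups of infinite index, and parabolic if it is the stabiliser in $G$ of a point of the boundary $\partial T$. Two subgroups $H,K\le G$ are automorphism equivalent if $\varphi(H)=K$ for some $\varphi\in\operatorname{Aut}(G)$, and $\operatorname{Aut}T$-equivalent if $fHf^{-1}=K$ for some $f\in \operatorname{Aut}T$. (1) Let $G\le\operatorname{Aut}T$ be a finitely generated branch group that contains a finite subgroup $Q$ which does not fix any point of $\partial T$. Then there are uncountably many automorphism equivalence classes of weakly maximal subgroups of $G$ that are distinct from the classes of all parabolic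 subgroups of $G$. (2) Let $p$ be an odd prime and $1\le m_1<m_2<\cdots$ integers, and let $T$ be the tree in which each vertex of level $i-1$ has $p^{m_i}$ children. Let $e_1,\dots,e_{p^{m_1}-1}$ be integers with $|e_i|\le p^{m_2}-1$, not all zero. For $n\ge 0$ let $T_n$ be the subtree of $T$ hanging from a vertex of level $n$, let $a_n$ be the rooted automorphism of $T_n$ permuting the $p^{m_{n+1}}$ first-level subtrees by the cycle $(1\,2\,\cdots\,p^{m_{n+1}})$, and let the automorphisms $b_n$ of $T_n$ fix the first level, with sections $b_0=(a_1^{e_1},\dots,a_1^{e_{p^{m_1}-1}},b_1)$ and $b_n=(a_{n+1}^{e_1},\dots,a_{n+1}^{e_{p^{m_1}-1}},1,\dots,1,b_{n+1})$ for $n\ge1$. Put $a=a_0$, $b=b_0$ and let $G=\langle a,b\rangle$ be the associated growing GGS-group. If $G$ is a branch group, then $G$ is finitely generated, $Q=\langle a\rangle$ is a finite subgroup of $G$ that does not fix any point of $\partial T$, and hence there are uncountably many automorphism equivalence classes of weakly maximal subgroups of $G$ that are distinct from the classes of all parabolic subgroups of $G$. Moreover, there are also uncountably many $\operatorname{Aut}T$-equivalence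 classes of weakly maximal subgroups of $G$ that are distinct from the $\operatorname{Aut}T$-equivalence classes of all parabolic subgroups of $G$. -/

import Mathlib

namespace BranchTree

/-- Vertices of level `n` of the spherically homogeneous rooted tree `T` with branching sequence
`d`: words of length `n` whose `i`-th letter lies in an alphabet with `d i` letters. A vertex of
level `n` has `d n` children. -/
abbrev Vertex (d : ℕ → ℕ) (n : ℕ) : Type := (i : Fin n) → Fin (d i)

/-- The boundary of the tree: infinite words. -/
abbrev Boundary (d : ℕ → ℕ) : Type := (i : ℕ) → Fin (d i)

/-- The prefix of length `n` of a vertex of level `k ≥ n`. -/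
def Vertex.take {d : ℕ → ℕ} {n k : ℕ} (h : n ≤ k) (v : Vertex d k) : Vertex d n :=
  fun i => v (Fin.castLE h i)

/-- The vertex of level `n` on the infinite path `ξ`. -/
def Boundary.take {d : ℕ → ℕ} (ξ : Boundary d) (n : ℕ) : Vertex d n := fun i => ξ i

/-- `u` is a prefix of `v`, that is, `v` is a vertex of the subtree rooted at `u`. -/
def IsPrefix {d : ℕ → ℕ} {n k : ℕ} (u : Vertex d n) (v : Vertex d k) : Prop :=
  ∃ h : n ≤ k, Vertex.take h v = u

/-- The group `Aut T` of automorphisms of the rooted tree: families of permutations of the levels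
which send children of a vertex to children of the image of that vertex. -/
def treeAut (d : ℕ → ℕ) : Subgroup ((n : ℕ) → Equiv.Perm (Vertex d n)) where
  carrier := {f | ∀ (n : ℕ) (v : Vertex d (n + 1)),
    Vertex.take (Nat.le_succ n) (f (n + 1) v) = f n (Vertex.take (Nat.le_succ n) v)}
  one_mem' := fun _ _ => rfl
  mul_mem' := by
    intro f g hf hg n v
    exact (hf n (g (n + 1) v)).trans (congrArg (f n) (hg n v))
  inv_mem' := by
    intro f hf n v
    have h : Vertex.take (Nat.le_succ n) (f (n + 1) ((f (n + 1))⁻¹ v))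
        = f n (Vertex.take (Nat.le_succ n) ((f (n + 1))⁻¹ v)) := hf n _
    have h1 : f (n + 1) ((f (n + 1))⁻¹ v) = v := Equiv.apply_symm_apply _ _
    rw [h1] at h
    exact ((f n).symm_apply_eq.mpr h).symm

abbrev TreeAut (d : ℕ → ℕ) : Type := treeAut d

/-- The permutation of level `n` induced by `f`. -/
def TreeAut.level {d : ℕ → ℕ} (f : TreeAut d) (n : ℕ) : Equiv.Perm (Vertex d n) := f.1 n

/-- The boundary point `ξ` is fixed by `f`. -/
def Fixes {d : ℕ → ℕ} (f : TreeAut d) (ξ : Boundary d) : Prop :=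
  ∀ n, f.level n (ξ.take n) = ξ.take n

/-- Transitivity on every level. -/
def SphericallyTransitive {d : ℕ → ℕ} (G : Subgroup (TreeAut d)) : Prop :=
  ∀ (n : ℕ) (u v : Vertex d n), ∃ g ∈ G, g.level n u = v

/-- The rigid stabiliser in `G` of the vertex `u`: the elements of `G` that fix every vertex not
having `u` as a prefix. -/
def rist {d : ℕ → ℕ} (G : Subgroup (TreeAut d)) {n : ℕ} (u : Vertex d n) :
    Subgroup (TreeAut d) where
  carrier := {g | g ∈ G ∧ ∀ (k : ℕ) (v : Vertex d k), ¬ IsPrefix u v → g.level k v = v}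
  one_mem' := ⟨G.one_mem, fun _ _ _ => rfl⟩
  mul_mem' := by
    rintro f g ⟨hfG, hf⟩ ⟨hgG, hg⟩
    refine ⟨G.mul_mem hfG hgG, fun k v hv => ?_⟩
    have h1 : (f * g).level k v = f.level k (g.level k v) := rfl
    rw [h1, hg k v hv, hf k v hv]
  inv_mem' := by
    rintro f ⟨hfG, hf⟩
    refine ⟨G.inv_mem hfG, fun k v hv => ?_⟩
    have h1 : (f⁻¹).level k v = (f.level k)⁻¹ v := rfl
    rw [h1, Equiv.Perm.inv_eq_iff_eq, hf k v hv]

/-- The rigid stabiliser of level `n`: the product of the (pairwise commuting) rigid stabilisers of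
the vertices of level `n`. -/
def ristLevel {d : ℕ → ℕ} (G : Subgroup (TreeAut d)) (n : ℕ) : Subgroup (TreeAut d) :=
  ⨆ u : Vertex d n, rist G u

/-- `G` is a branch group: it is spherically transitive and all its rigid level stabilisers have
finite index in `G`. -/
def IsBranch {d : ℕ → ℕ} (G : Subgroup (TreeAut d)) : Prop :=
  SphericallyTransitive G ∧ ∀ n, ((ristLevel G n).subgroupOf G).FiniteIndex

/-- The parabolic subgroup of `G` at `ξ`: the stabiliser of the boundary point `ξ`. -/
def parabolic {d : ℕ → ℕ} (G : Subgroup (TreeAut d)) (ξ : Boundary d) : Subgroup G where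
  carrier := {g | Fixes (g : TreeAut d) ξ}
  one_mem' := fun _ => rfl
  mul_mem' := by
    intro f g hf hg n
    have h1 : ((f * g : G) : TreeAut d).level n (ξ.take n)
      = (f : TreeAut d).level n ((g : TreeAut d).level n (ξ.take n)) := rfl
    rw [h1, hg n, hf n]
  inv_mem' := by
    intro f hf n
    have h1 : ((f⁻¹ : G) : TreeAut d).level n (ξ.take n)
      = ((f : TreeAut d).level n)⁻¹ (ξ.take n) := rfl
    rw [h1, Equiv.Perm.inv_eq_iff_eq, hf n]

/-- A weakly maximal subgroup: maximal among the subgroups of infinite index. -/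
def IsWeaklyMaximal {Γ : Type*} [Group Γ] (W : Subgroup Γ) : Prop :=
  Maximal (fun K : Subgroup Γ => ¬ K.FiniteIndex) W

/-- The automorphism equivalence class of a subgroup `H` of `Γ`: its orbit under `Aut Γ`. -/
def autClass {Γ : Type*} [Group Γ] (H : Subgroup Γ) : Set (Subgroup Γ) :=
  {K | ∃ φ : Γ ≃* Γ, H.map φ.toMonoidHom = K}

/-- The `Aut T`-equivalence class of a subgroup `H` of `G ≤ Aut T`: all subgroups of `G` that are
conjugate to `H` by an arbitrary automorphism of `T`. -/
def treeClass {d : ℕ → ℕ} (G : Subgroup (TreeAut d)) (H : Subgroup G) : Set (Subgroup G) :=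
  {K | ∃ f : TreeAut d,
    (H.map G.subtype).map (MulAut.conj f).toMonoidHom = K.map G.subtype}

/-- The action on level `n` given by a labelling: the image of the word `x₀ x₁ ⋯` has `i`-th letter
`l (x₀ ⋯ xᵢ₋₁) xᵢ`, where the permutation `l u` is the label at the vertex `u`. -/
def portraitMap {d : ℕ → ℕ} (l : (n : ℕ) → Vertex d n → Equiv.Perm (Fin (d n))) (n : ℕ)
    (v : Vertex d n) : Vertex d n :=
  fun i => l i (Vertex.take i.2.le v) (v i)

theorem portraitMap_injective {d : ℕ → ℕ} (l : (n : ℕ) → Vertex d n → Equiv.Perm (Fin (d n)))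
    (n : ℕ) : Function.Injective (portraitMap l n) := by
  intro v w h
  have key : ∀ (i : ℕ) (hi : i < n), v ⟨i, hi⟩ = w ⟨i, hi⟩ := by
    intro i
    induction i using Nat.strong_induction_on with
    | _ i ih =>
      intro hi
      have ht : Vertex.take hi.le v = Vertex.take hi.le w := by
        funext j
        exact ih j j.2 (j.2.trans hi)
      have h2 : l i (Vertex.take hi.le v) (v ⟨i, hi⟩) = l i (Vertex.take hi.le w) (w ⟨i, hi⟩) :=
        congrFun h ⟨i, hi⟩
      rw [ht] at h2
      exact (l i _).injective h2
  funext i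
  exact key i i.2

/-- The automorphism of `T` with a prescribed labelling. -/
noncomputable def ofPortrait {d : ℕ → ℕ} (l : (n : ℕ) → Vertex d n → Equiv.Perm (Fin (d n))) :
    TreeAut d :=
  ⟨fun n => Equiv.ofBijective (portraitMap l n)
    (Finite.injective_iff_bijective.mp (portraitMap_injective l n)), fun _ _ => rfl⟩

/-- The branching sequence `(p ^ m₁, p ^ m₂, …)`, where `m i` stands for `mᵢ₊₁`. -/
def growingDeg (p : ℕ) (m : ℕ → ℕ) : ℕ → ℕ := fun i => p ^ m i

/-- The rooted automorphism `a`: it permutes the first letter by the cycle `x ↦ x + 1`. -/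
noncomputable def ggsA (p : ℕ) (m : ℕ → ℕ) : TreeAut (growingDeg p m) :=
  ofPortrait fun n _ =>
    match n with
    | 0 => finRotate (growingDeg p m 0)
    | _ + 1 => 1

open Classical in
/-- The labelling of the directed automorphism
`b = (a₁ ^ e₁, …, a₁ ^ e_r, b₁)`, `bₙ = (aₙ₊₁ ^ e₁, …, aₙ₊₁ ^ e_r, 1, …, 1, bₙ₊₁)`, `r = p ^ m₁ - 1`.
Letters are numbered from `0`, and `e k` stands for `eₖ₊₁`. A vertex `u` has a nontrivial label only
if all its letters but the last one are the greatest letters of their alphabets, while its last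
letter is some `k < r`; the label is then the `e k`-th power of the cycle `x ↦ x + 1`. -/
noncomputable def ggsBLabel (p : ℕ) (m : ℕ → ℕ) (e : Fin (p ^ m 0 - 1) → ℤ) :
    (n : ℕ) → Vertex (growingDeg p m) n → Equiv.Perm (Fin (growingDeg p m n))
  | 0, _ => 1
  | n + 1, u =>
    if h : (u (Fin.last n) : ℕ) < p ^ m 0 - 1 ∧
        ∀ i : Fin n, (u i.castSucc : ℕ) + 1 = growingDeg p m i
    then finRotate (growingDeg p m (n + 1)) ^ e ⟨u (Fin.last n), h.1⟩
    else 1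

/-- The directed automorphism `b`. -/
noncomputable def ggsB (p : ℕ) (m : ℕ → ℕ) (e : Fin (p ^ m 0 - 1) → ℤ) :
    TreeAut (growingDeg p m) :=
  ofPortrait (ggsBLabel p m e)

/-- The growing GGS-group with defining vector `e`, generated by `a` and `b`. -/
noncomputable def growingGGS (p : ℕ) (m : ℕ → ℕ) (e : Fin (p ^ m 0 - 1) → ℤ) :
    Subgroup (TreeAut (growingDeg p m)) :=
  Subgroup.closure {ggsA p m, ggsB p m e}

end BranchTree

namespace BranchTree

open scoped commutatorElement

variable {d : ℕ → ℕ}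

/-! Weakly maximal subgroups are obtained as setwise stabilisers of thin subtrees `C`: orbits of a
ray under a subgroup of `G` whose levels have proportion tending to zero. Thinness gives infinite
index. An element violating invariance of `C` moves a vertex into or out of `C`, so any overgroup
containing it captures the rigid stabiliser of one vertex of `C`, then of every vertex of that
level, and so has finite index (`IsThinSubtree.isWeaklyMaximal`). A thin subtree is determined by
its stabiliser, even up to conjugation in `Aut T` (`IsThinSubtree.mem_of_conj`), because rigid
stabilisers have orbits of positive proportion below their vertex.

For automorphism classes, take `C` to be the `Q`-orbit of a ray; its stabiliser contains `Q`. The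
image of a parabolic subgroup under any automorphism of `G` fixes a vertex on every level
(`exists_level_fixed`), so if it contained `Q`, compactness would give a boundary point fixed by
`Q`. Each class is countable since `G` is finitely generated, and only finitely many rays share a
`Q`-orbit, while the boundary is uncountable.

For `Aut T`-classes in a GGS-group, conjugates of powers of `b` supply a tower of elements along one
ray, each acting essentially as a rooted rotation at its own level (`exists_rooted_ggs`). The
elements indexed by a set `A` of naturals generate a group whose orbit of the ray gains new
branching at the `i`-th of these levels exactly when `i ∈ A`. Level sizes of the orbit are invariant
under `Aut T`, so they recover `A`; parabolic subgroups have constant level size 1 and account only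
for the empty set. -/

theorem level_mul (f g : TreeAut d) (n : ℕ) (v : Vertex d n) :
    (f * g).level n v = f.level n (g.level n v) := rfl

theorem level_one (n : ℕ) (v : Vertex d n) : (1 : TreeAut d).level n v = v := rfl

theorem level_inv_level (f : TreeAut d) (n : ℕ) (v : Vertex d n) :
    (f⁻¹).level n (f.level n v) = v := (f.level n).symm_apply_apply v

theorem level_level_inv (f : TreeAut d) (n : ℕ) (v : Vertex d n) :
    f.level n ((f⁻¹).level n v) = v := (f.level n).apply_symm_apply v

theorem treeAut_ext {f g : TreeAut d} (h : ∀ n v, f.level n v = g.level n v) : f = g :=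
  Subtype.ext (funext fun n => Equiv.ext (h n))

theorem take_level (f : TreeAut d) {n k : ℕ} (h : n ≤ k) (v : Vertex d k) :
    Vertex.take h (f.level k v) = f.level n (Vertex.take h v) := by
  induction k, h using Nat.le_induction with
  | base => rfl
  | succ k hk ih =>
    have h1 : Vertex.take (Nat.le_succ k) (f.level (k + 1) v)
        = f.level k (Vertex.take (Nat.le_succ k) v) := f.2 k v
    have h2 := ih (Vertex.take (Nat.le_succ k) v)
    rw [← h1] at h2
    exact h2

/-! ### Prefixes and extensions of vertices. -/

theorem IsPrefix.refl {n : ℕ} (u : Vertex d n) : IsPrefix u u := ⟨le_rfl, rfl⟩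

theorem IsPrefix.trans {n k l : ℕ} {u : Vertex d n} {v : Vertex d k} {w : Vertex d l}
    (h : IsPrefix u v) (h' : IsPrefix v w) : IsPrefix u w := by
  obtain ⟨h1, rfl⟩ := h
  obtain ⟨h2, rfl⟩ := h'
  exact ⟨h1.trans h2, rfl⟩

theorem IsPrefix.eq_of_level_eq {n k : ℕ} {u v : Vertex d n} {w : Vertex d k}
    (h : IsPrefix u w) (h' : IsPrefix v w) : u = v := by
  obtain ⟨h1, rfl⟩ := h
  obtain ⟨h2, rfl⟩ := h'
  rfl

theorem IsPrefix.eq {n : ℕ} {u v : Vertex d n} (h : IsPrefix u v) : u = v :=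
  h.eq_of_level_eq (IsPrefix.refl v)

theorem IsPrefix.map {n k : ℕ} {u : Vertex d n} {v : Vertex d k} (h : IsPrefix u v)
    (f : TreeAut d) : IsPrefix (f.level n u) (f.level k v) := by
  obtain ⟨h1, rfl⟩ := h
  exact ⟨h1, take_level f h1 v⟩

theorem isPrefix_boundary (ξ : Boundary d) {n k : ℕ} (h : n ≤ k) :
    IsPrefix (ξ.take n) (ξ.take k) := ⟨h, rfl⟩

theorem exists_boundary (hd : ∀ n, 1 ≤ d n) {n : ℕ} (v : Vertex d n) :
    ∃ ξ : Boundary d, ξ.take n = v := by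
  refine ⟨fun i => if h : i < n then v ⟨i, h⟩ else ⟨0, hd i⟩, ?_⟩
  funext i
  simp [Boundary.take]

theorem exists_extension (hd : ∀ n, 1 ≤ d n) {n k : ℕ} (h : n ≤ k) (v : Vertex d n) :
    ∃ w : Vertex d k, IsPrefix v w := by
  obtain ⟨ξ, rfl⟩ := exists_boundary hd v
  exact ⟨ξ.take k, isPrefix_boundary ξ h⟩

/-! ### Rigid stabilisers -/

theorem level_of_mem_rist {G : Subgroup (TreeAut d)} {n : ℕ} {u : Vertex d n} {g : TreeAut d}
    (hg : g ∈ rist G u) : g.level n u = u := by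
  by_contra h
  have h1 : ¬ IsPrefix u (g.level n u) := fun h' => h h'.eq.symm
  exact h ((g.level n).injective (hg.2 n _ h1))

theorem IsPrefix.level_of_mem_rist {G : Subgroup (TreeAut d)} {n k : ℕ} {u : Vertex d n}
    {v : Vertex d k} {g : TreeAut d} (h : IsPrefix u v) (hg : g ∈ rist G u) :
    IsPrefix u (g.level k v) := by
  have := h.map g
  rwa [BranchTree.level_of_mem_rist hg] at this

theorem rist_conj {G : Subgroup (TreeAut d)} {n : ℕ} {u : Vertex d n} {g x : TreeAut d}
    (hg : g ∈ G) (hx : x ∈ rist G u) : g * x * g⁻¹ ∈ rist G (g.level n u) := by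
  refine ⟨G.mul_mem (G.mul_mem hg hx.1) (G.inv_mem hg), fun k v hv => ?_⟩
  have h : ¬ IsPrefix u ((g⁻¹).level k v) := by
    intro h
    apply hv
    have := h.map g
    rwa [level_level_inv] at this
  rw [level_mul, level_mul, hx.2 k _ h, level_level_inv]

theorem rist_anti {G : Subgroup (TreeAut d)} {n k : ℕ} {u : Vertex d n} {v : Vertex d k}
    (h : IsPrefix u v) : rist G v ≤ rist G u :=
  fun _ hg => ⟨hg.1, fun l w hw => hg.2 l w fun h' => hw (h.trans h')⟩

/-- The supports are the disjoint subtrees at `u` and `v`, each preserved by both elements. -/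
theorem rist_commute {G : Subgroup (TreeAut d)} {n : ℕ} {u v : Vertex d n} (huv : u ≠ v)
    {x y : TreeAut d} (hx : x ∈ rist G u) (hy : y ∈ rist G v) : x * y = y * x := by
  refine treeAut_ext fun k t => ?_
  rw [level_mul, level_mul]
  have key : ∀ {s : Vertex d k}, IsPrefix u s → ¬ IsPrefix v s :=
    fun h h' => huv (h.eq_of_level_eq h')
  by_cases hu : IsPrefix u t
  · rw [hy.2 k t (key hu), hy.2 k _ (key (hu.level_of_mem_rist hx))]
  · rw [hx.2 k t hu]
    by_cases hv : IsPrefix v t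
    · exact hx.2 k _ fun h => key h (hv.level_of_mem_rist hy)
    · rw [hy.2 k t hv, hx.2 k t hu]

/-- Below `v`, an element of the rigid level stabiliser acts as an element of `rist G v`. -/
theorem exists_rist_eq_below {G : Subgroup (TreeAut d)} {n : ℕ} (v : Vertex d n) {g : TreeAut d}
    (hg : g ∈ ristLevel G n) :
    ∃ h ∈ rist G v, ∀ (k : ℕ) (w : Vertex d k), IsPrefix v w → g.level k w = h.level k w := by
  refine Subgroup.iSup_induction (fun u : Vertex d n => rist G u)
    (C := fun g => ∃ h ∈ rist G v, ∀ (k : ℕ) (w : Vertex d k), IsPrefix v w →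
      g.level k w = h.level k w) hg ?_ ⟨1, Subgroup.one_mem _, fun _ _ _ => rfl⟩ ?_
  · intro u x hx
    by_cases huv : u = v
    · subst huv
      exact ⟨x, hx, fun _ _ _ => rfl⟩
    · exact ⟨1, Subgroup.one_mem _,
        fun k w hw => hx.2 k w fun h => huv (h.eq_of_level_eq hw)⟩
  · rintro x y ⟨x', hx', hx⟩ ⟨y', hy', hy⟩
    refine ⟨x' * y', Subgroup.mul_mem _ hx' hy', fun k w hw => ?_⟩
    rw [level_mul, level_mul, hy k w hw, hx k _ (hw.level_of_mem_rist hy')]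

/-- An orbit of a subgroup of finite index occupies a definite proportion of its level. -/
theorem card_level_le {G : Subgroup (TreeAut d)} (hG : SphericallyTransitive G) (H : Subgroup G)
    [H.FiniteIndex] {n : ℕ} (w : Vertex d n) (S : Set (Vertex d n))
    (hS : ∀ h ∈ H, (h : TreeAut d).level n w ∈ S) :
    Fintype.card (Vertex d n) ≤ H.index * S.ncard := by
  have hsurj : Function.Surjective
      (fun q : (G ⧸ H) × S => ((q.1.out : G) : TreeAut d).level n q.2.1) := by
    intro v
    obtain ⟨g, hg, rfl⟩ := hG n w v
    -- The chosen representative of the coset of `g` is `g * h`, so it sends `h⁻¹ w`, a point of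
    -- `S`, to `g w`.
    obtain ⟨h, hh⟩ := QuotientGroup.mk_out_eq_mul H ⟨g, hg⟩
    refine ⟨(((⟨g, hg⟩ : G) : G ⧸ H), ⟨_, hS _ (H.inv_mem h.2)⟩), ?_⟩
    simp only [hh]
    rw [← level_mul]
    simp
  have := Nat.card_le_card_of_surjective _ hsurj
  rwa [Nat.card_prod, Nat.card_eq_fintype_card] at this

/-- Below `v` the finite-index subgroup `ristLevel G n` has the same orbits as `rist G v`, so
`card_level_le` applies to the latter although it may have infinite index. -/
theorem card_level_le_rist {G : Subgroup (TreeAut d)} (hG : IsBranch G) {n k : ℕ}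
    {v : Vertex d n} {w : Vertex d k} (hvw : IsPrefix v w) (S : Set (Vertex d k))
    (hS : ∀ h ∈ rist G v, h.level k w ∈ S) :
    Fintype.card (Vertex d k) ≤ ((ristLevel G n).subgroupOf G).index * S.ncard := by
  have := hG.2 n
  refine card_level_le hG.1 _ w S fun h hh => ?_
  obtain ⟨x, hx, hx'⟩ := exists_rist_eq_below v (Subgroup.mem_subgroupOf.mp hh)
  rw [hx' k w hvw]
  exact hS x hx

/-! ### Growth of levels -/

theorem card_vertex_succ (n : ℕ) :
    Fintype.card (Vertex d (n + 1)) = Fintype.card (Vertex d n) * d n := by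
  simp [Vertex, Fintype.card_pi, Fin.prod_univ_castSucc]

/-- A sequence of sizes that infinitely often fails to grow with the levels becomes negligible. -/
theorem eventually_mul_lt_card (hd : ∀ n, 1 ≤ d n) {a : ℕ → ℕ} (h0 : a 0 ≤ 1)
    (ha : ∀ n, a (n + 1) ≤ a n * d n)
    (hinf : ∀ N, ∃ n, N ≤ n ∧ 2 ≤ d n ∧ a (n + 1) ≤ a n) (K : ℕ) :
    ∃ N, ∀ n, N ≤ n → K * a n < Fintype.card (Vertex d n) := by
  have hpos : ∀ n, 0 < Fintype.card (Vertex d n) := fun n => by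
    have : ∀ i : Fin n, NeZero (d i) := fun i => ⟨Nat.one_le_iff_ne_zero.mp (hd i)⟩
    exact Fintype.card_pos
  have step : ∀ c N, c * a N ≤ Fintype.card (Vertex d N) →
      ∀ n, N ≤ n → c * a n ≤ Fintype.card (Vertex d n) := by
    intro c N h n hn
    induction n, hn using Nat.le_induction with
    | base => exact h
    | succ n _ ih =>
      rw [card_vertex_succ]
      calc c * a (n + 1) ≤ c * (a n * d n) := Nat.mul_le_mul_left _ (ha n)
        _ = c * a n * d n := by ring
        _ ≤ _ := Nat.mul_le_mul_right _ ih
  -- By `step`, a lower bound on the ratio of the level size to `a n` persists; it doubles at every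
  -- level where `a` does not grow and `d n ≥ 2`.
  have main : ∀ K, ∃ N, ∀ n, N ≤ n → 2 ^ K * a n ≤ Fintype.card (Vertex d n) := by
    intro K
    induction K with
    | zero =>
      refine ⟨0, step 1 0 ?_⟩
      have := hpos 0
      omega
    | succ K ih =>
      obtain ⟨N, hN⟩ := ih
      obtain ⟨n, hn, hdn, han⟩ := hinf N
      refine ⟨n + 1, step (2 ^ (K + 1)) (n + 1) ?_⟩
      rw [card_vertex_succ]
      calc 2 ^ (K + 1) * a (n + 1) ≤ 2 ^ (K + 1) * a n := Nat.mul_le_mul_left _ han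
        _ = 2 ^ K * a n * 2 := by ring
        _ ≤ _ := Nat.mul_le_mul (hN n hn) hdn
  obtain ⟨N, hN⟩ := main K
  refine ⟨N, fun n hn => ?_⟩
  rcases Nat.eq_zero_or_pos (a n) with h | h
  · rw [h, mul_zero]
    exact hpos n
  · exact (Nat.mul_lt_mul_of_pos_right Nat.lt_two_pow_self h).trans_le (hN n hn)

theorem eventually_lt_card (hd : ∀ n, 1 ≤ d n) (hd2 : ∀ n, ∃ k, n ≤ k ∧ 2 ≤ d k) (K : ℕ) :
    ∃ N, ∀ n, N ≤ n → K < Fintype.card (Vertex d n) := by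
  have := eventually_mul_lt_card hd (a := fun _ => 1) le_rfl (fun n => by simpa using hd n)
    (fun N => (hd2 N).imp fun n hn => ⟨hn.1, hn.2, le_rfl⟩) K
  simpa using this

/-! ### Stabilisers of thin subtrees -/

/-- The setwise stabiliser in `G` of a set of vertices given level by level. -/
def setStabilizer (G : Subgroup (TreeAut d)) (C : (n : ℕ) → Set (Vertex d n)) : Subgroup G where
  carrier := {g | ∀ n v, v ∈ C n ↔ (g : TreeAut d).level n v ∈ C n}
  one_mem' := fun _ _ => Iff.rfl
  mul_mem' := fun {_ _} hf hg n v => (hg n v).trans (hf n _)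
  inv_mem' := fun {f} hf n v => by
    have := hf n (((f : TreeAut d)⁻¹).level n v)
    rw [level_level_inv] at this
    exact this.symm

/-- A subtree without dead ends whose stabiliser in `G` acts transitively on each of its levels,
and whose levels form a negligible part of the levels of the whole tree. -/
structure IsThinSubtree (G : Subgroup (TreeAut d)) (C : (n : ℕ) → Set (Vertex d n)) : Prop where
  take_mem : ∀ {n k : ℕ} {u : Vertex d n} {v : Vertex d k}, IsPrefix u v → v ∈ C k → u ∈ C n
  nonempty : ∀ n, (C n).Nonempty
  transitive : ∀ n, ∀ u ∈ C n, ∀ v ∈ C n, ∃ g ∈ setStabilizer G C, (g : TreeAut d).level n u = v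
  thin : ∀ K, ∃ N, ∀ n, N ≤ n → K * (C n).ncard < Fintype.card (Vertex d n)

variable {G : Subgroup (TreeAut d)} {C C' : (n : ℕ) → Set (Vertex d n)}

/-- `C` is closed under prefixes, so it misses the whole subtree at `v`, the only place where `g`
acts. -/
theorem IsThinSubtree.rist_le (hC : IsThinSubtree G C) {n : ℕ} {v : Vertex d n} (hv : v ∉ C n)
    {g : G} (hg : (g : TreeAut d) ∈ rist G v) : g ∈ setStabilizer G C := by
  intro k u
  by_cases h : IsPrefix v u
  · exact iff_of_false (fun hu => hv (hC.take_mem h hu))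
      (fun hu => hv (hC.take_mem (h.level_of_mem_rist hg) hu))
  · rw [hg.2 k u h]

/-- Some vertex of level `n` extends, since `C k` is nonempty; transitivity carries the extension to
any other vertex. -/
theorem IsThinSubtree.exists_extension (hC : IsThinSubtree G C) {n k : ℕ} (h : n ≤ k)
    {v : Vertex d n} (hv : v ∈ C n) : ∃ w ∈ C k, IsPrefix v w := by
  obtain ⟨w, hw⟩ := hC.nonempty k
  have hp : IsPrefix (Vertex.take h w) w := ⟨h, rfl⟩
  obtain ⟨g, hg, rfl⟩ := hC.transitive n _ (hC.take_mem hp hw) v hv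
  exact ⟨_, (hg k w).mp hw, hp.map g⟩

/-- Rigid stabilisers off `C` already lie in the stabiliser. If `g` in an overgroup `K` moves a
vertex across the border of `C`, conjugating by `g` puts the rigid stabiliser of one vertex of `C n`
in `K`, and transitivity on `C n` yields all of `ristLevel G n`. -/
theorem IsThinSubtree.isWeaklyMaximal (hG : IsBranch G) (hC : IsThinSubtree G C) :
    IsWeaklyMaximal (setStabilizer G C) := by
  constructor
  · intro hfin
    obtain ⟨N, hN⟩ := hC.thin (setStabilizer G C).index
    obtain ⟨w, hw⟩ := hC.nonempty N
    exact (hN N le_rfl).not_ge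
      (card_level_le hG.1 (setStabilizer G C) w (C N) fun h hh => (hh N w).mp hw)
  · intro K hK hle
    by_contra hKW
    apply hK
    obtain ⟨g, hgK, hgW⟩ := SetLike.not_le_iff_exists.mp hKW
    obtain ⟨n, u, hu, hru⟩ : ∃ n, ∃ u ∈ C n, ∀ x : G, (x : TreeAut d) ∈ rist G u → x ∈ K := by
      have : ¬ ∀ n v, v ∈ C n ↔ (g : TreeAut d).level n v ∈ C n := hgW
      push Not at this
      obtain ⟨n, v, ⟨h1, h2⟩ | ⟨h1, h2⟩⟩ := this
      · refine ⟨n, v, h1, fun x hx => ?_⟩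
        have h3 : g * x * g⁻¹ ∈ K := hle (hC.rist_le h2 (rist_conj g.2 hx))
        have := K.mul_mem (K.mul_mem (K.inv_mem hgK) h3) hgK
        simpa [mul_assoc] using this
      · refine ⟨n, _, h2, fun x hx => ?_⟩
        have h3 : g⁻¹ * x * g ∈ K := by
          refine hle (hC.rist_le h1 ?_)
          have := rist_conj (G.inv_mem g.2) hx
          rw [level_inv_level, inv_inv] at this
          exact this
        have := K.mul_mem (K.mul_mem hgK h3) (K.inv_mem hgK)
        simpa [mul_assoc] using this
    have := hG.2 n
    refine Subgroup.finiteIndex_of_le (H := (ristLevel G n).subgroupOf G) ?_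
    have hle' : ristLevel G n ≤ K.map G.subtype := by
      refine iSup_le fun v x hx => ⟨⟨x, hx.1⟩, ?_, rfl⟩
      by_cases hv : v ∈ C n
      · obtain ⟨w, hw, rfl⟩ := hC.transitive n u hu v hv
        have h3 : w⁻¹ * ⟨x, hx.1⟩ * w ∈ K := by
          refine hru _ ?_
          have := rist_conj (G.inv_mem w.2) hx
          rw [level_inv_level, inv_inv] at this
          exact this
        have := K.mul_mem (K.mul_mem (hle hw) h3) (K.inv_mem (hle hw))
        simpa [mul_assoc] using this
      · exact hle (hC.rist_le hv hx)
    intro x hx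
    obtain ⟨y, hy, hyx⟩ := hle' (Subgroup.mem_subgroupOf.mp hx)
    rwa [← Subtype.ext hyx]

/-- A thin subtree can be recovered from its stabiliser, even up to conjugation in `Aut T`. -/
theorem IsThinSubtree.mem_of_conj (hG : IsBranch G) (hC : IsThinSubtree G C)
    (hC' : IsThinSubtree G C') {f : TreeAut d}
    (hf : ∀ g ∈ setStabilizer G C, ∃ g' ∈ setStabilizer G C', f * g * f⁻¹ = (g' : TreeAut d))
    {n : ℕ} {v : Vertex d n} (hv : f.level n v ∈ C' n) : v ∈ C n := by
  by_contra hvC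
  obtain ⟨N, hN⟩ := hC'.thin ((ristLevel G n).subgroupOf G).index
  -- At a deep level `k`, `f` conjugates `rist G v` into the stabiliser of `C'`, so an orbit of
  -- positive proportion is confined to the negligible set `f⁻¹ (C' k)`.
  set k := max n N
  obtain ⟨w, hw, hvw⟩ := hC'.exists_extension (le_max_left n N) hv
  have hvw' : IsPrefix v ((f⁻¹).level k w) := by
    have := hvw.map f⁻¹
    rwa [level_inv_level] at this
  have h1 := card_level_le_rist hG hvw' ((f⁻¹).level k '' C' k) fun h hh => by
    obtain ⟨g', hg', hfg⟩ := hf ⟨h, hh.1⟩ (hC.rist_le hvC hh)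
    refine ⟨_, (hg' k w).mp hw, ?_⟩
    rw [← hfg, ← level_mul, ← level_mul]
    congr 2
    simp [mul_assoc]
  rw [Set.ncard_image_of_injective _ ((f⁻¹).level k).injective] at h1
  exact (hN k (le_max_right n N)).not_ge h1

theorem IsThinSubtree.mem_iff_of_treeClass (hG : IsBranch G) (hC : IsThinSubtree G C)
    (hC' : IsThinSubtree G C') (h : setStabilizer G C' ∈ treeClass G (setStabilizer G C)) :
    ∃ f : TreeAut d, ∀ n v, v ∈ C n ↔ f.level n v ∈ C' n := by
  obtain ⟨f, hf⟩ := h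
  refine ⟨f, fun n v => ⟨fun hv => ?_, fun hv => ?_⟩⟩
  · refine hC'.mem_of_conj hG hC (f := f⁻¹) (fun g hg => ?_) (by rwa [level_inv_level])
    have : (g : TreeAut d) ∈ (setStabilizer G C').map G.subtype := ⟨g, hg, rfl⟩
    rw [← hf] at this
    obtain ⟨_, ⟨x, hx, rfl⟩, hxg⟩ := this
    refine ⟨x, hx, ?_⟩
    rw [← hxg]
    simp [mul_assoc]
  · refine hC.mem_of_conj hG hC' (f := f) (fun g hg => ?_) hv
    have : f * g * f⁻¹ ∈ (setStabilizer G C').map G.subtype := by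
      rw [← hf]
      exact ⟨_, ⟨g, hg, rfl⟩, rfl⟩
    obtain ⟨x, hx, hxg⟩ := this
    exact ⟨x, hx, hxg.symm⟩

theorem IsThinSubtree.eq_of_setStabilizer_eq (hG : IsBranch G) (hC : IsThinSubtree G C)
    (hC' : IsThinSubtree G C') (h : setStabilizer G C = setStabilizer G C') : C = C' := by
  funext n
  ext v
  refine ⟨fun hv => ?_, fun hv => ?_⟩
  · exact hC'.mem_of_conj hG hC (f := 1) (fun g hg => ⟨g, h ▸ hg, by simp⟩) hv
  · exact hC.mem_of_conj hG hC' (f := 1) (fun g hg => ⟨g, h ▸ hg, by simp⟩) hv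

/-- The orbit of a ray under a subgroup of `G` is a thin subtree as soon as it is thin. -/
theorem isThinSubtree_orbit {L : Subgroup (TreeAut d)} (hL : L ≤ G) (ξ : Boundary d)
    (hthin : ∀ K, ∃ N, ∀ n, N ≤ n →
      K * {v | ∃ g ∈ L, v = g.level n (ξ.take n)}.ncard < Fintype.card (Vertex d n)) :
    IsThinSubtree G (fun n => {v | ∃ g ∈ L, v = g.level n (ξ.take n)}) where
  take_mem := by
    rintro n k u _ ⟨h, rfl⟩ ⟨g, hg, rfl⟩
    exact ⟨g, hg, take_level g h _⟩
  nonempty n := ⟨ξ.take n, 1, L.one_mem, rfl⟩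
  transitive := by
    rintro n _ ⟨g, hg, rfl⟩ _ ⟨h, hh, rfl⟩
    refine ⟨⟨h * g⁻¹, hL (L.mul_mem hh (L.inv_mem hg))⟩, fun k v => ⟨?_, ?_⟩, ?_⟩
    · rintro ⟨x, hx, rfl⟩
      exact ⟨_, L.mul_mem (L.mul_mem hh (L.inv_mem hg)) hx, rfl⟩
    · rintro ⟨x, hx, hv⟩
      refine ⟨_, L.mul_mem (L.inv_mem (L.mul_mem hh (L.inv_mem hg))) hx, ?_⟩
      rw [level_mul, ← hv, level_inv_level]
    · change (h * g⁻¹).level n _ = _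
      rw [level_mul, level_inv_level]
  thin := hthin

/-- Makes parabolic subgroups the case of the trivial group, so that they can be compared with other
orbit stabilisers. -/
theorem parabolic_eq_setStabilizer (G : Subgroup (TreeAut d)) (ξ : Boundary d) :
    parabolic G ξ = setStabilizer G (fun n => {v | ∃ g ∈ (⊥ : Subgroup (TreeAut d)),
      v = g.level n (ξ.take n)}) := by
  ext g
  have hmem : ∀ n (v : Vertex d n), (∃ g ∈ (⊥ : Subgroup (TreeAut d)),
      v = g.level n (ξ.take n)) ↔ v = ξ.take n := fun n v =>
    ⟨fun ⟨x, hx, h⟩ => by rw [h, Subgroup.mem_bot.mp hx, level_one],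
      fun h => ⟨1, Subgroup.one_mem _, h⟩⟩
  constructor
  · intro hg n v
    simp only [Set.mem_ofPred_eq, hmem]
    have := hg n
    constructor
    · rintro rfl
      exact this
    · intro h
      exact ((g : TreeAut d).level n).injective (h.trans this.symm)
  · intro hg n
    have := hg n (ξ.take n)
    simp only [Set.mem_ofPred_eq, hmem, true_iff] at this
    exact this

/-! ### Automorphisms of a branch group and its boundary action -/

theorem exists_level_ne {g : TreeAut d} (hg : g ≠ 1) : ∃ n v, g.level n v ≠ v := by
  by_contra! h
  exact hg (treeAut_ext h)

/-- If `rist G u` met `M` trivially it would embed in `G ⧸ M`; its orbits would have bounded size,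
although they occupy a definite proportion of levels of unbounded size. -/
theorem exists_mem_rist_ne_one (hd : ∀ n, 1 ≤ d n) (hd2 : ∀ n, ∃ k, n ≤ k ∧ 2 ≤ d k)
    (hG : IsBranch G) (M : Subgroup G) [M.FiniteIndex] {n : ℕ} (u : Vertex d n) :
    ∃ x : G, (x : TreeAut d) ∈ rist G u ∧ x ∈ M ∧ x ≠ 1 := by
  by_contra! h
  obtain ⟨N, hN⟩ := eventually_lt_card hd hd2 (((ristLevel G n).subgroupOf G).index * M.index)
  obtain ⟨k, hnk, hNk⟩ : ∃ k, n ≤ k ∧ N ≤ k := ⟨_, le_max_left n N, le_max_right n N⟩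
  obtain ⟨w, hw⟩ := exists_extension hd hnk u
  let S : Set (Vertex d k) :=
    Set.range fun x : (rist G u).subgroupOf G => ((x : G) : TreeAut d).level k w
  have h1 := card_level_le_rist hG hw S fun x hx => ⟨⟨⟨x, hx.1⟩, hx⟩, rfl⟩
  have h2 : S.ncard ≤ M.index := by
    choose x hx using fun s : S => s.2
    refine Nat.card_le_card_of_injective (fun s : S => ((x s : G) : G ⧸ M)) fun s t hst => ?_
    have h3 : (x s : G)⁻¹ * x t ∈ M := QuotientGroup.eq.mp hst
    have h4 := h _ ((rist G u).mul_mem ((rist G u).inv_mem (x s).2) (x t).2) h3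
    have h5 : (x s : G) = x t := (inv_mul_eq_one.mp h4)
    refine Subtype.ext ?_
    rw [← hx s, ← hx t]
    simp only [h5]
  exact (hN k hNk).not_ge (h1.trans (Nat.mul_le_mul_left _ h2))

/-- Nontrivial subgroups of the rigid stabilisers which shrink along the tree are not abelian. -/
theorem exists_not_commute (N : (n : ℕ) → Vertex d n → Subgroup G)
    (hN : ∀ {n} {u : Vertex d n} {x : G}, x ∈ N n u → (x : TreeAut d) ∈ rist G u)
    (hmono : ∀ {n k} {u : Vertex d n} {w : Vertex d k}, IsPrefix u w → N k w ≤ N n u)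
    (hne : ∀ n u, ∃ x ∈ N n u, x ≠ 1) {n : ℕ} (u : Vertex d n) :
    ∃ x ∈ N n u, ∃ y ∈ N n u, x * y ≠ y * x := by
  obtain ⟨g, hg, hg1⟩ := hne n u
  obtain ⟨k, w, hgw⟩ := exists_level_ne (g := (g : TreeAut d)) fun h => hg1 (Subtype.ext h)
  have huw : IsPrefix u w := by
    by_contra h
    exact hgw ((hN hg).2 k w h)
  obtain ⟨x, hx, hx1⟩ := hne k w
  obtain ⟨l, t, hxt⟩ := exists_level_ne (g := (x : TreeAut d)) fun h => hx1 (Subtype.ext h)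
  have hwt : IsPrefix w t := by
    by_contra h
    exact hxt ((hN hx).2 l t h)
  -- `g` moves `w`, hence carries `t` out of the support of `x`; commuting with `g` would force `x`
  -- to fix `t`.
  refine ⟨g, hg, x, hmono huw hx, fun h => hxt ?_⟩
  have h1 : (g : TreeAut d).level l ((x : TreeAut d).level l t)
      = (x : TreeAut d).level l ((g : TreeAut d).level l t) :=
    congrArg (fun z : G => (z : TreeAut d).level l t) h
  rw [(hN hx).2 l ((g : TreeAut d).level l t)
    fun h' => hgw ((hwt.map (g : TreeAut d)).eq_of_level_eq h')] at h1
  exact ((g : TreeAut d).level l).injective h1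

/-- The part of the rigid stabiliser of `u` in a subgroup `M` of `G`. -/
def ristIn (M : Subgroup G) {n : ℕ} (u : Vertex d n) : Subgroup G :=
  (rist G u).subgroupOf G ⊓ M

theorem ristIn_anti (M : Subgroup G) {n k : ℕ} {u : Vertex d n} {w : Vertex d k}
    (h : IsPrefix u w) : ristIn M w ≤ ristIn M u :=
  fun _ hx => ⟨rist_anti h hx.1, hx.2⟩

/-- `exists_not_commute` is used twice: the groups `ristIn M u` are not abelian, so their derived
subgroups are nontrivial, and these again shrink along the tree. -/
theorem exists_commutator_not_commute (hd : ∀ n, 1 ≤ d n) (hd2 : ∀ n, ∃ k, n ≤ k ∧ 2 ≤ d k)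
    (hG : IsBranch G) (M : Subgroup G) [M.FiniteIndex] {n : ℕ} (u : Vertex d n) :
    ∃ x ∈ ⁅ristIn M u, ristIn M u⁆, ∃ y ∈ ⁅ristIn M u, ristIn M u⁆, x * y ≠ y * x := by
  refine exists_not_commute (fun n u => ⁅ristIn M u, ristIn M u⁆) ?_ ?_ ?_ u
  · intro n u x hx
    exact (Subgroup.commutator_le_self _ hx).1
  · intro n k u w h
    exact Subgroup.commutator_mono (ristIn_anti M h) (ristIn_anti M h)
  · intro n u
    obtain ⟨x, hx, y, hy, hxy⟩ := exists_not_commute (fun n u => ristIn M u) (fun h => h.1)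
      (fun h => ristIn_anti M h) (fun n u => by
        obtain ⟨x, h1, h2, h3⟩ := exists_mem_rist_ne_one hd hd2 hG M u
        exact ⟨x, ⟨h1, h2⟩, h3⟩) u
    exact ⟨⁅x, y⁆, Subgroup.commutator_mem_commutator hx hy,
      fun h => hxy (commutatorElement_eq_one_iff_mul_comm.mp h)⟩

/-- The permutation of a level induced by the elements of `G`. -/
def levelHom (G : Subgroup (TreeAut d)) (n : ℕ) : G →* Equiv.Perm (Vertex d n) where
  toFun g := (g : TreeAut d).level n
  map_one' := rfl
  map_mul' _ _ := rfl

/-- If an element `g` of `G` moves `u`, then every subgroup which contains `g` and is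
normalised by `M` contains the commutators of `M ∩ rist G u`. -/
theorem commutator_ristIn_le {M A : Subgroup G} (hM : ∀ m ∈ M, ∀ a ∈ A, m * a * m⁻¹ ∈ A)
    {n : ℕ} {u : Vertex d n} {g : G} (hg : g ∈ A) (hgu : (g : TreeAut d).level n u ≠ u) :
    ⁅ristIn M u, ristIn M u⁆ ≤ A := by
  refine Subgroup.commutator_le.mpr fun x hx y hy => ?_
  have hz : (g * x⁻¹ * g⁻¹ : G) * y = y * (g * x⁻¹ * g⁻¹) :=
    Subtype.ext (rist_commute hgu (rist_conj g.2 ((rist G u).inv_mem hx.1)) hy.1)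
  -- With `z = g x⁻¹ g⁻¹`, supported below `g u` and hence commuting with `y`, the element `t = ⁅x,
  -- g⁆ = x z` of `A` satisfies `⁅x, y⁆ = ⁅t, y⁆`.
  have ht : x * g * x⁻¹ * g⁻¹ ∈ A := A.mul_mem (hM x hx.2 g hg) (A.inv_mem hg)
  have h2 : (x * g * x⁻¹ * g⁻¹) * (y * (x * g * x⁻¹ * g⁻¹)⁻¹ * y⁻¹) ∈ A :=
    A.mul_mem ht (hM y hy.2 _ (A.inv_mem ht))
  convert h2 using 1
  have e1 : x * g * x⁻¹ * g⁻¹ = x * (g * x⁻¹ * g⁻¹) := by group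
  rw [e1]
  generalize g * x⁻¹ * g⁻¹ = z at hz
  rw [commutatorElement_def]
  calc x * y * x⁻¹ * y⁻¹ = x * (y * z) * z⁻¹ * x⁻¹ * y⁻¹ := by group
    _ = x * (z * y) * z⁻¹ * x⁻¹ * y⁻¹ := by rw [hz]
    _ = _ := by group

/-- For an automorphism `φ` of a branch group, a boundary point `ξ` and a level `n`, the image of
the parabolic subgroup at `ξ` fixes a vertex of level `n`. -/
theorem exists_level_fixed (hd : ∀ n, 1 ≤ d n) (hd2 : ∀ n, ∃ k, n ≤ k ∧ 2 ≤ d k)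
    (hG : IsBranch G) (φ : G ≃* G) (ξ : Boundary d) (n : ℕ) :
    ∃ v : Vertex d n, ∀ g ∈ parabolic G ξ, (φ g : TreeAut d).level n v = v := by
  have : Nonempty (Vertex d n) := ⟨fun i => ⟨0, hd i⟩⟩
  obtain ⟨v₀⟩ := this
  obtain ⟨x, hx, -, hx1⟩ := exists_mem_rist_ne_one hd hd2 hG ⊤ v₀
  have hx1' : ((φ.symm x : G) : TreeAut d) ≠ 1 := fun h =>
    hx1 ((φ.symm.map_eq_one_iff).mp (Subtype.ext h))
  obtain ⟨k, u₀, hu₀⟩ := exists_level_ne hx1'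
  -- `R` will be the graph of an equivariant map from level `k` to level `n`, for the `G`-action
  -- twisted by `φ` on the target. The level `k` is chosen so that `R` is nonempty.
  let R : Vertex d n → Vertex d k → Prop := fun v u =>
    ∃ g : G, (φ g : TreeAut d) ∈ rist G v ∧ (g : TreeAut d).level k u ≠ u
  have hequiv : ∀ (h : G) v u, R v u →
      R ((φ h : TreeAut d).level n v) ((h : TreeAut d).level k u) := by
    rintro h v u ⟨g, hg, hgu⟩
    refine ⟨h * g * h⁻¹, ?_, fun h' => hgu ?_⟩
    · rw [map_mul, map_mul, map_inv]
      exact rist_conj (φ h).2 hg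
    · have h2 : ((h * g * h⁻¹ : G) : TreeAut d).level k ((h : TreeAut d).level k u)
          = (h : TreeAut d).level k ((g : TreeAut d).level k u) := by
        change (h * g * (h : TreeAut d)⁻¹).level k _ = _
        rw [level_mul, level_mul, level_inv_level]
      exact ((h : TreeAut d).level k).injective (h2.symm.trans h')
  -- If `u` were related to `v ≠ w`, the derived subgroup of `ristIn M u` would lie in the preimages
  -- of both `rist G v` and `rist G w`, which commute elementwise; but it is not abelian.
  have huniq : ∀ u v w, R v u → R w u → v = w := by
    rintro u v w ⟨g, hg, hgu⟩ ⟨g', hg', hgu'⟩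
    by_contra hvw
    let M : Subgroup G := ((levelHom G n).comp φ.toMonoidHom).ker
    have hMfin : M.FiniteIndex :=
      inferInstanceAs ((levelHom G n).comp φ.toMonoidHom).ker.FiniteIndex
    have hnorm : ∀ v : Vertex d n, ∀ m ∈ M,
        ∀ a ∈ ((rist G v).subgroupOf G).comap φ.toMonoidHom,
        m * a * m⁻¹ ∈ ((rist G v).subgroupOf G).comap φ.toMonoidHom := by
      intro v m hm a ha
      have h1 : (φ m : TreeAut d).level n v = v := congrArg (fun σ => σ v) (show
        levelHom G n (φ m) = 1 from hm)
      have h2 := rist_conj (φ m).2 (show (φ a : TreeAut d) ∈ rist G v from ha)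
      rw [h1] at h2
      change (φ (m * a * m⁻¹) : TreeAut d) ∈ rist G v
      rw [map_mul, map_mul, map_inv]
      exact h2
    obtain ⟨x, hx, y, hy, hxy⟩ := exists_commutator_not_commute hd hd2 hG M u
    have h1 : (φ x : TreeAut d) ∈ rist G v := commutator_ristIn_le (hnorm v) hg hgu hx
    have h2 : (φ y : TreeAut d) ∈ rist G w := commutator_ristIn_le (hnorm w) hg' hgu' hy
    refine hxy (φ.injective ?_)
    rw [map_mul, map_mul]
    exact Subtype.ext (rist_commute hvw h1 h2)
  -- By transitivity the vertex of level `k` on `ξ` is related to some vertex of level `n`;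
  -- equivariance and uniqueness make the image of the parabolic subgroup fix the latter.
  obtain ⟨h, hh, hhu⟩ := hG.1 k u₀ (ξ.take k)
  have hR := hequiv ⟨h, hh⟩ v₀ u₀ ⟨φ.symm x, by rwa [MulEquiv.apply_symm_apply], hu₀⟩
  refine ⟨_, fun g hg => huniq _ _ _ ?_ hR⟩
  have h3 := hequiv g _ _ hR
  have h4 : (g : TreeAut d).level k (h.level k u₀) = h.level k u₀ := by
    rw [hhu]
    exact hg k
  change R _ ((g : TreeAut d).level k (h.level k u₀)) at h3
  rw [h4] at h3
  exact h3

/-- A group which fixes a vertex on each level fixes a boundary point. -/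
theorem exists_boundary_fixed (hd : ∀ n, 1 ≤ d n) (Q : Set (TreeAut d))
    (h : ∀ n, ∃ v : Vertex d n, ∀ q ∈ Q, q.level n v = v) :
    ∃ ξ : Boundary d, ∀ q ∈ Q, Fixes q ξ := by
  -- These sets are nonempty, closed and decreasing in the compact boundary.
  let t : ℕ → Set (Boundary d) := fun n => {ξ | ∀ q ∈ Q, q.level n (ξ.take n) = ξ.take n}
  have hclosed : ∀ n, IsClosed (t n) := by
    intro n
    have hc : Continuous fun ξ : Boundary d => ξ.take n :=
      continuous_pi fun i => continuous_apply _
    exact (isClosed_discrete {v : Vertex d n | ∀ q ∈ Q, q.level n v = v}).preimage hc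
  obtain ⟨ξ, hξ⟩ := IsCompact.nonempty_iInter_of_sequence_nonempty_isCompact_isClosed t
    (fun n ξ hξ q hq => by
      have h1 := congrArg (Vertex.take (Nat.le_succ n)) (hξ q hq)
      rwa [take_level] at h1)
    (fun n => by
      obtain ⟨v, hv⟩ := h n
      obtain ⟨ξ, rfl⟩ := exists_boundary hd v
      exact ⟨ξ, hv⟩) (hclosed 0).isCompact hclosed
  exact ⟨ξ, fun q hq n => Set.mem_iInter.mp hξ n q hq⟩

/-! ### Counting -/

/-- The group is countable, and an automorphism is determined by its values on finitely many
generators. -/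
theorem countable_mulEquiv {Γ : Type*} [Group Γ] (h : Group.FG Γ) : Countable (Γ ≃* Γ) := by
  obtain ⟨α, _, φ, hφ⟩ := Group.fg_iff_exists_freeGroup_hom_surjective_finite.mp h
  have : Countable (FreeGroup α) := inferInstanceAs (Countable (Quot _))
  have : Countable Γ := hφ.countable
  have hinj : Function.Injective fun (ψ : Γ ≃* Γ) (a : α) => ψ (φ (FreeGroup.of a)) := by
    intro ψ ψ' h
    have h1 : ψ.toMonoidHom.comp φ = ψ'.toMonoidHom.comp φ :=
      FreeGroup.ext_hom _ _ fun a => congrFun h a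
    ext x
    obtain ⟨y, rfl⟩ := hφ x
    exact DFunLike.congr_fun h1 y
  exact hinj.countable

theorem countable_autClass {Γ : Type*} [Group Γ] (h : Group.FG Γ) (H : Subgroup Γ) :
    (autClass H).Countable := by
  have := countable_mulEquiv h
  have : autClass H = Set.range fun φ : Γ ≃* Γ => H.map φ.toMonoidHom := rfl
  rw [this]
  exact Set.countable_range _

theorem mem_autClass_self {Γ : Type*} [Group Γ] (H : Subgroup Γ) : H ∈ autClass H :=
  ⟨MulEquiv.refl Γ, Subgroup.map_id H⟩

theorem mem_treeClass_self (H : Subgroup G) : H ∈ treeClass G H :=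
  ⟨1, by rw [map_one]; exact Subgroup.map_id _⟩

theorem not_countable_of_injective_set {α : Type*} {f : Set ℕ → α} (hf : Function.Injective f) :
    ¬ Countable α := by
  intro h
  have := hf.countable
  obtain ⟨g, hg⟩ := exists_surjective_nat (Set ℕ)
  exact Function.cantor_surjective g hg

theorem not_countable_boundary (hd : ∀ n, 1 ≤ d n) (hd2 : ∀ n, ∃ k, n ≤ k ∧ 2 ≤ d k) :
    ¬ Countable (Boundary d) := by
  classical
  have hinf : {i | 2 ≤ d i}.Infinite := Set.infinite_of_not_bddAbove fun ⟨b, hb⟩ => by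
    obtain ⟨k, hk, hdk⟩ := hd2 (b + 1)
    have := hb hdk
    omega
  let s := Nat.nth fun i => 2 ≤ d i
  have hs : ∀ j, 2 ≤ d (s j) := Nat.nth_mem_of_infinite hinf
  have hsinj : Function.Injective s := Nat.nth_injective hinf
  -- A set of naturals is encoded by letters 0 and 1 at the infinitely many levels with a choice;
  -- all other letters are 0.
  let f : Set ℕ → Boundary d := fun B i =>
    if h : 2 ≤ d i ∧ i ∈ s '' B then ⟨1, h.1⟩ else ⟨0, hd i⟩
  have hf : ∀ B j, j ∈ B ↔ (f B (s j) : ℕ) = 1 := by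
    intro B j
    by_cases hj : j ∈ B
    · simp [f, hj, hs j, hsinj.eq_iff]
    · simp [f, hj, hsinj.eq_iff]
  refine not_countable_of_injective_set (f := f) fun B B' h => ?_
  ext j
  rw [hf, hf, h]

/-- Only finitely many rays have the same orbit under a finite group. -/
theorem finite_same_orbit {Q : Subgroup (TreeAut d)} [Finite Q] (ξ : Boundary d) :
    {η : Boundary d | ∀ n, ∃ q ∈ Q, η.take n = q.level n (ξ.take n)}.Finite := by
  have key : ∀ η : {η : Boundary d | ∀ n, ∃ q ∈ Q, η.take n = q.level n (ξ.take n)},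
      ∃ q : Q, ∀ n, η.1.take n = (q : TreeAut d).level n (ξ.take n) := by
    rintro ⟨η, hη⟩
    -- If every `q` failed at some level, finiteness of `Q` would give one level at which all of
    -- them fail. So a single `q` works for all levels, and it determines `η`.
    by_contra! h
    choose m hm using h
    obtain ⟨N, hN⟩ := (Set.finite_range m).bddAbove
    obtain ⟨q, hq, hηq⟩ := hη N
    apply hm ⟨q, hq⟩
    have h1 := congrArg (Vertex.take (hN (Set.mem_range_self ⟨q, hq⟩))) hηq
    rwa [take_level] at h1
  choose q hq using key
  refine Finite.of_injective q fun η η' h => ?_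
  refine Subtype.ext (funext fun i => ?_)
  have h1 : η.1.take (i + 1) = η'.1.take (i + 1) := by rw [hq, hq, h]
  exact congrFun h1 (Fin.last i)

/-- Weakly maximal subgroups containing a given finite subgroup of a branch group. -/
theorem not_countable_autClass (hd : ∀ n, 1 ≤ d n) (hd2 : ∀ n, ∃ k, n ≤ k ∧ 2 ≤ d k)
    (hfg : G.FG) (hG : IsBranch G) (Q : Subgroup (TreeAut d)) (hQG : Q ≤ G) [Finite Q]
    (hQ : ∀ ξ : Boundary d, ∃ q ∈ Q, ¬ Fixes q ξ) :
    ¬ Set.Countable {c : Set (Subgroup G) |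
      (∃ W : Subgroup G, IsWeaklyMaximal W ∧ c = autClass W) ∧
      ∀ ξ : Boundary d, c ≠ autClass (parabolic G ξ)} := by
  intro hcount
  let C : Boundary d → (n : ℕ) → Set (Vertex d n) :=
    fun ξ n => {v | ∃ g ∈ Q, v = g.level n (ξ.take n)}
  have hC : ∀ ξ, IsThinSubtree G (C ξ) := by
    refine fun ξ => isThinSubtree_orbit hQG ξ fun K => ?_
    obtain ⟨N, hN⟩ := eventually_lt_card hd hd2 (K * Nat.card Q)
    refine ⟨N, fun n hn => lt_of_le_of_lt (Nat.mul_le_mul_left _ ?_) (hN n hn)⟩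
    refine Nat.card_le_card_of_surjective
      (fun q : Q => (⟨(q : TreeAut d).level n (ξ.take n), q, q.2, rfl⟩ : C ξ n)) ?_
    rintro ⟨_, g, hg, rfl⟩
    exact ⟨⟨g, hg⟩, rfl⟩
  have hQW : ∀ ξ, ∀ q (hq : q ∈ Q), (⟨q, hQG hq⟩ : G) ∈ setStabilizer G (C ξ) := by
    intro ξ q hq n v
    constructor
    · rintro ⟨g, hg, rfl⟩
      exact ⟨q * g, Q.mul_mem hq hg, rfl⟩
    · rintro ⟨g, hg, h⟩
      refine ⟨q⁻¹ * g, Q.mul_mem (Q.inv_mem hq) hg, ?_⟩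
      rw [level_mul, ← h]
      exact (level_inv_level q n v).symm
  have hmem : ∀ ξ, autClass (setStabilizer G (C ξ)) ∈ {c : Set (Subgroup G) |
      (∃ W : Subgroup G, IsWeaklyMaximal W ∧ c = autClass W) ∧
      ∀ ξ : Boundary d, c ≠ autClass (parabolic G ξ)} := by
    -- Were the class parabolic, `Q` would lie in an automorphic image of a parabolic subgroup,
    -- hence fix a vertex on each level and then a boundary point.
    refine fun ξ => ⟨⟨_, (hC ξ).isWeaklyMaximal hG, rfl⟩, fun η hη => ?_⟩
    obtain ⟨φ, hφ⟩ : setStabilizer G (C ξ) ∈ autClass (parabolic G η) :=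
      hη ▸ mem_autClass_self _
    obtain ⟨ζ, hζ⟩ := exists_boundary_fixed hd Q fun n => by
      obtain ⟨v, hv⟩ := exists_level_fixed hd hd2 hG φ η n
      refine ⟨v, fun q hq => ?_⟩
      have h1 := hQW ξ q hq
      rw [← hφ] at h1
      obtain ⟨g, hg, hgq⟩ := h1
      have h2 := hv g hg
      rw [show φ g = ⟨q, hQG hq⟩ from hgq] at h2
      exact h2
    obtain ⟨q, hq, hq'⟩ := hQ ζ
    exact hq' (hζ q hq)
  have hfg' : Group.FG G := (Group.fg_iff_subgroup_fg G).mpr hfg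
  have hc2 : (⋃ c ∈ {c : Set (Subgroup G) |
      (∃ W : Subgroup G, IsWeaklyMaximal W ∧ c = autClass W) ∧
      ∀ ξ : Boundary d, c ≠ autClass (parabolic G ξ)}, c).Countable := by
    refine hcount.biUnion fun c hc => ?_
    obtain ⟨⟨W, -, rfl⟩, -⟩ := hc
    exact countable_autClass hfg' W
  -- Every ray belongs to the fibre of its stabiliser; fibres are finite because the stabiliser
  -- determines the `Q`-orbit.
  have hc3 : (⋃ W ∈ (⋃ c ∈ {c : Set (Subgroup G) |
      (∃ W : Subgroup G, IsWeaklyMaximal W ∧ c = autClass W) ∧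
      ∀ ξ : Boundary d, c ≠ autClass (parabolic G ξ)}, c),
      {ξ : Boundary d | setStabilizer G (C ξ) = W}).Countable := by
    refine hc2.biUnion fun W _ => ?_
    rcases Set.eq_empty_or_nonempty {ξ : Boundary d | setStabilizer G (C ξ) = W} with h | ⟨ξ, hξ⟩
    · rw [h]
      exact Set.countable_empty
    · refine ((finite_same_orbit (Q := Q) ξ).subset fun η hη n => ?_).countable
      have h1 : C η = C ξ := (hC η).eq_of_setStabilizer_eq hG (hC ξ) (hη.trans hξ.symm)
      have h2 : η.take n ∈ C η n := ⟨1, Q.one_mem, rfl⟩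
      rw [h1] at h2
      exact h2
  refine not_countable_boundary hd hd2 (Set.countable_univ_iff.mp (hc3.mono fun ξ _ => ?_))
  exact Set.mem_biUnion (Set.mem_biUnion (hmem ξ) (mem_autClass_self _)) rfl

/-! ### Towers of rooted elements along a ray -/

/-- The stabiliser of a vertex in `Aut T`. -/
def vertexStabilizer {n : ℕ} (v : Vertex d n) : Subgroup (TreeAut d) where
  carrier := {g | g.level n v = v}
  one_mem' := rfl
  mul_mem' := fun {f g} hf hg => by
    change f.level n (g.level n v) = v
    rw [show g.level n v = v from hg, show f.level n v = v from hf]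
  inv_mem' := fun {f} hf => by
    have := level_inv_level f n v
    rwa [show f.level n v = v from hf] at this

theorem vertexStabilizer_anti {n k : ℕ} {u : Vertex d n} {v : Vertex d k} (h : IsPrefix u v) :
    vertexStabilizer v ≤ vertexStabilizer u := by
  intro g hg
  have := h.map g
  rw [show g.level k v = v from hg] at this
  exact this.eq_of_level_eq h

/-- Elements `h i` supported below the prefix of length `k i` of the ray `ξ`, fixing the prefix of
length `n i ≥ k i`, and such that the powers of `h i` that fix the next vertex of the ray are
trivial below the prefix of length `n i`. The intervals `[k i, n i]` cover `ℕ`. -/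
structure IsRootedTower (G : Subgroup (TreeAut d)) (ξ : Boundary d) (k n : ℕ → ℕ)
    (h : ℕ → TreeAut d) : Prop where
  start_zero : k 0 = 0
  start_le : ∀ i, k i ≤ n i
  start_succ : ∀ i, k (i + 1) = n i + 1
  mem_rist : ∀ i, h i ∈ rist G (ξ.take (k i))
  level_eq : ∀ i, (h i).level (n i) (ξ.take (n i)) = ξ.take (n i)
  rooted : ∀ i (s : ℤ), (h i ^ s).level (n i + 1) (ξ.take (n i + 1)) = ξ.take (n i + 1) →
    ∀ l (v : Vertex d l), IsPrefix (ξ.take (n i)) v → (h i ^ s).level l v = v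

/-- The group generated by the elements of a sequence from the `i`-th on. -/
def tailGroup (h : ℕ → TreeAut d) (i : ℕ) : Subgroup (TreeAut d) :=
  Subgroup.closure (h '' Set.Ici i)

namespace IsRootedTower

variable {ξ : Boundary d} {k n : ℕ → ℕ} {h : ℕ → TreeAut d}

theorem start_monotone (H : IsRootedTower G ξ k n h) : Monotone k :=
  monotone_nat_of_le_succ fun i => by
    rw [H.start_succ i]
    exact (H.start_le i).trans (Nat.le_succ _)

theorem end_monotone (H : IsRootedTower G ξ k n h) : Monotone n :=
  monotone_nat_of_le_succ fun i => by
    have := H.start_le (i + 1)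
    rw [H.start_succ i] at this
    omega

theorem tailGroup_le_rist (H : IsRootedTower G ξ k n h) (i : ℕ) :
    tailGroup h i ≤ rist G (ξ.take (k i)) := by
  refine (Subgroup.closure_le _).mpr ?_
  rintro _ ⟨j, hj, rfl⟩
  exact rist_anti (isPrefix_boundary ξ (H.start_monotone hj)) (H.mem_rist j)

theorem tailGroup_le_vertexStabilizer (H : IsRootedTower G ξ k n h) (i : ℕ) :
    tailGroup h i ≤ vertexStabilizer (ξ.take (n i)) := by
  refine (Subgroup.closure_le _).mpr ?_
  rintro _ ⟨j, hj, rfl⟩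
  exact vertexStabilizer_anti (isPrefix_boundary ξ (H.end_monotone hj)) (H.level_eq j)

/-- A normal form below `ξ.take (n i + 1)`: a power of `h i` either is trivial there or moves this
subtree to where the later elements are trivial. Allowing an initial power `s` makes the induction
on products of generators go through. -/
theorem exists_tail_below (H : IsRootedTower G ξ k n h) (i : ℕ) {g : TreeAut d}
    (hg : g ∈ tailGroup h i) (s : ℤ) : ∃ s' : ℤ, ∃ t ∈ tailGroup h (i + 1),
      ∀ l (y : Vertex d l), IsPrefix (ξ.take (n i + 1)) y →
        g.level l ((h i ^ s).level l y) = (h i ^ s').level l (t.level l y) := by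
  have hpre : IsPrefix (ξ.take (n i)) (ξ.take (n i + 1)) := isPrefix_boundary ξ (Nat.le_succ _)
  have hle : tailGroup h (i + 1) ≤ rist G (ξ.take (n i + 1)) := by
    have := H.tailGroup_le_rist (i + 1)
    rwa [H.start_succ] at this
  have tail : ∀ t ∈ tailGroup h (i + 1), ∀ s : ℤ, ∃ s' : ℤ, ∃ t' ∈ tailGroup h (i + 1),
      ∀ l (y : Vertex d l), IsPrefix (ξ.take (n i + 1)) y →
        t.level l ((h i ^ s).level l y) = (h i ^ s').level l (t'.level l y) := by
    intro t ht s
    by_cases hs : (h i ^ s).level (n i + 1) (ξ.take (n i + 1)) = ξ.take (n i + 1)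
    · refine ⟨0, t, ht, fun l y hy => ?_⟩
      rw [H.rooted i s hs l y (hpre.trans hy), zpow_zero, level_one]
    · refine ⟨s, 1, Subgroup.one_mem _, fun l y hy => ?_⟩
      exact (hle ht).2 l _ fun h' => hs ((hy.map _).eq_of_level_eq h')
  have power : ∀ z s : ℤ, ∃ s' : ℤ, ∃ t' ∈ tailGroup h (i + 1),
      ∀ l (y : Vertex d l), IsPrefix (ξ.take (n i + 1)) y →
        (h i ^ z).level l ((h i ^ s).level l y) = (h i ^ s').level l (t'.level l y) := by
    intro z s
    refine ⟨z + s, 1, Subgroup.one_mem _, fun l y _ => ?_⟩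
    rw [zpow_add, level_mul, level_one]
  induction hg using Subgroup.closure_induction'' generalizing s with
  | mem x hx =>
    obtain ⟨j, hj, rfl⟩ := hx
    rcases eq_or_lt_of_le (show i ≤ j from hj) with rfl | hij
    · simpa using power 1 s
    · exact tail _ (Subgroup.subset_closure ⟨j, hij, rfl⟩) s
  | inv_mem x hx =>
    obtain ⟨j, hj, rfl⟩ := hx
    rcases eq_or_lt_of_le (show i ≤ j from hj) with rfl | hij
    · simpa using power (-1) s
    · exact tail _ (Subgroup.inv_mem _ (Subgroup.subset_closure ⟨j, hij, rfl⟩)) s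
  | one => exact ⟨s, 1, Subgroup.one_mem _, fun l y _ => rfl⟩
  | mul x y _ _ hx hy =>
    obtain ⟨s₁, t₁, ht₁, h₁⟩ := hy s
    obtain ⟨s₂, t₂, ht₂, h₂⟩ := hx s₁
    refine ⟨s₂, t₂ * t₁, Subgroup.mul_mem _ ht₂ ht₁, fun l v hv => ?_⟩
    rw [level_mul, level_mul, h₁ l v hv, h₂ l _ (hv.level_of_mem_rist (hle ht₁))]

/-- An element of the group of the tower which fixes a vertex of the ray acts below it as an
element of the tail. -/
theorem exists_tail_eq (H : IsRootedTower G ξ k n h) (i : ℕ) {g : TreeAut d}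
    (hg : g ∈ tailGroup h 0) (hgi : g ∈ vertexStabilizer (ξ.take (k i))) :
    ∃ t ∈ tailGroup h i, ∀ l (y : Vertex d l), IsPrefix (ξ.take (k i)) y →
      g.level l y = t.level l y := by
  induction i with
  | zero => exact ⟨g, hg, fun _ _ _ => rfl⟩
  | succ i ih =>
    have hk : k i ≤ k (i + 1) := H.start_monotone (Nat.le_succ i)
    obtain ⟨t, ht, hgt⟩ := ih (vertexStabilizer_anti (isPrefix_boundary ξ hk) hgi)
    obtain ⟨s, t', ht', htt⟩ := H.exists_tail_below i ht 0
    have hle := H.tailGroup_le_rist (i + 1) ht'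
    have hg' : ∀ l (y : Vertex d l), IsPrefix (ξ.take (k (i + 1))) y →
        g.level l y = (h i ^ s).level l (t'.level l y) := by
      intro l y hy
      rw [hgt l y ((isPrefix_boundary ξ hk).trans hy)]
      have := htt l y (by rwa [← H.start_succ])
      rwa [zpow_zero, level_one] at this
    refine ⟨t', ht', fun l y hy => ?_⟩
    rw [hg' l y hy]
    -- Both `g` and `t'` fix `ξ.take (k (i + 1))`, so the remaining power of `h i` fixes it too and
    -- is trivial below.
    refine H.rooted i s ?_ l _ ?_
    · have h1 := hg' _ _ (IsPrefix.refl _)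
      rw [level_of_mem_rist hle, show g.level _ (ξ.take (k (i + 1))) = _ from hgi] at h1
      have h2 : h i ^ s ∈ vertexStabilizer (ξ.take (k (i + 1))) := h1.symm
      rw [H.start_succ] at h2
      exact h2
    · refine (isPrefix_boundary ξ ?_).trans (hy.level_of_mem_rist hle)
      rw [H.start_succ]
      exact Nat.le_succ _

theorem exists_mem_interval (H : IsRootedTower G ξ k n h) (l : ℕ) : ∃ i, k i ≤ l ∧ l ≤ n i := by
  induction l with
  | zero => exact ⟨0, H.start_zero.le, Nat.zero_le _⟩
  | succ l ih =>
    obtain ⟨i, h1, h2⟩ := ih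
    rcases eq_or_lt_of_le h2 with h3 | h3
    · refine ⟨i + 1, (H.start_succ i).trans_le (by omega), ?_⟩
      have := H.start_le (i + 1)
      rw [H.start_succ] at this
      omega
    · exact ⟨i, by omega, h3⟩

/-- The orbit of the ray branches only at the levels `n i` for which `h i` moves the next vertex of
the ray. -/
theorem mem_vertexStabilizer_succ (H : IsRootedTower G ξ k n h) {l : ℕ}
    (hl : ∀ i, l = n i → h i ∈ vertexStabilizer (ξ.take (l + 1))) {g : TreeAut d}
    (hg : g ∈ tailGroup h 0) (hgl : g ∈ vertexStabilizer (ξ.take l)) :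
    g ∈ vertexStabilizer (ξ.take (l + 1)) := by
  obtain ⟨i, h1, h2⟩ := H.exists_mem_interval l
  obtain ⟨t, ht, hgt⟩ :=
    H.exists_tail_eq i hg (vertexStabilizer_anti (isPrefix_boundary ξ h1) hgl)
  suffices h3 : t ∈ vertexStabilizer (ξ.take (l + 1)) by
    exact (hgt _ _ (isPrefix_boundary ξ (by omega))).trans h3
  -- At `l = n i` the later elements start only below level `n i + 1`, which leaves `h i`; for
  -- smaller `l` the whole tail fixes `ξ.take (n i)`.
  rcases eq_or_lt_of_le h2 with h3 | h3
  · have hle : tailGroup h i ≤ vertexStabilizer (ξ.take (l + 1)) := by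
      refine (Subgroup.closure_le _).mpr ?_
      rintro _ ⟨j, hj, rfl⟩
      rcases eq_or_lt_of_le (show i ≤ j from hj) with rfl | hij
      · exact hl i h3
      · have h4 := H.start_monotone (show i + 1 ≤ j from hij)
        rw [H.start_succ] at h4
        exact vertexStabilizer_anti (isPrefix_boundary ξ (by omega))
          (level_of_mem_rist (H.mem_rist j))
    exact hle ht
  · exact vertexStabilizer_anti (isPrefix_boundary ξ h3) (H.tailGroup_le_vertexStabilizer i ht)

end IsRootedTower

/-! ### Sizes of orbits -/

/-- The orbit of the prefix of length `n` of the ray `ξ`. -/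
def rayOrbit (L : Subgroup (TreeAut d)) (ξ : Boundary d) (n : ℕ) : Set (Vertex d n) :=
  {v | ∃ g ∈ L, v = g.level n (ξ.take n)}

theorem image_rayOrbit (L : Subgroup (TreeAut d)) (ξ : Boundary d) (n : ℕ) :
    Vertex.take (Nat.le_succ n) '' rayOrbit L ξ (n + 1) = rayOrbit L ξ n := by
  ext v
  constructor
  · rintro ⟨_, ⟨g, hg, rfl⟩, rfl⟩
    exact ⟨g, hg, take_level g _ _⟩
  · rintro ⟨g, hg, rfl⟩
    exact ⟨_, ⟨g, hg, rfl⟩, take_level g _ _⟩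

theorem ncard_rayOrbit_succ_le (L : Subgroup (TreeAut d)) (ξ : Boundary d) (n : ℕ) :
    (rayOrbit L ξ (n + 1)).ncard ≤ (rayOrbit L ξ n).ncard * d n := by
  have hinj : Function.Injective fun v : rayOrbit L ξ (n + 1) =>
      ((⟨Vertex.take (Nat.le_succ n) v.1, by
        rw [← image_rayOrbit]
        exact ⟨_, v.2, rfl⟩⟩, v.1 (Fin.last n)) : rayOrbit L ξ n × Fin (d n)) := by
    rintro ⟨u, hu⟩ ⟨v, hv⟩ huv
    simp only [Prod.mk.injEq, Subtype.mk.injEq] at huv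
    refine Subtype.ext (funext fun i => ?_)
    rcases Fin.eq_castSucc_or_eq_last i with ⟨j, rfl⟩ | rfl
    · exact congrFun huv.1 j
    · exact huv.2
  have := Nat.card_le_card_of_injective _ hinj
  rwa [Nat.card_prod, Nat.card_eq_fintype_card (α := Fin (d n)), Fintype.card_fin] at this

/-- Truncation maps one orbit onto the other, and by transitivity its injectivity can be tested at
the ray. -/
theorem ncard_rayOrbit_succ_eq_iff (L : Subgroup (TreeAut d)) (ξ : Boundary d) (n : ℕ) :
    (rayOrbit L ξ n).ncard = (rayOrbit L ξ (n + 1)).ncard ↔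
      ∀ g ∈ L, g ∈ vertexStabilizer (ξ.take n) → g ∈ vertexStabilizer (ξ.take (n + 1)) := by
  rw [← image_rayOrbit, Set.ncard_image_iff]
  constructor
  · intro h g hg hgn
    refine h ⟨g, hg, rfl⟩ ⟨1, L.one_mem, rfl⟩ ?_
    rw [take_level]
    exact hgn
  · rintro h _ ⟨g, hg, rfl⟩ _ ⟨g', hg', rfl⟩ hgg
    rw [take_level, take_level] at hgg
    have h1 := h (g'⁻¹ * g) (L.mul_mem (L.inv_mem hg') hg) (by
      change (g'⁻¹).level n (g.level n (ξ.take n)) = ξ.take n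
      rw [show g.level n (ξ.take n) = g'.level n (ξ.take n) from hgg, level_inv_level])
    have h2 : (g'⁻¹).level _ (g.level _ (ξ.take (n + 1))) = ξ.take (n + 1) := h1
    rw [← level_level_inv g' _ (g.level _ _), h2]

theorem isThinSubtree_rayOrbit (hd : ∀ n, 1 ≤ d n) {L : Subgroup (TreeAut d)} (hL : L ≤ G)
    (ξ : Boundary d)
    (hinf : ∀ N, ∃ n, N ≤ n ∧ 2 ≤ d n ∧
      ∀ g ∈ L, g ∈ vertexStabilizer (ξ.take n) → g ∈ vertexStabilizer (ξ.take (n + 1))) :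
    IsThinSubtree G (rayOrbit L ξ) := by
  refine isThinSubtree_orbit hL ξ (eventually_mul_lt_card hd
    (a := fun n => (rayOrbit L ξ n).ncard) ?_ (ncard_rayOrbit_succ_le L ξ) fun N => ?_)
  · refine (Set.ncard_le_one).mpr fun u _ v _ => ?_
    exact funext fun i => i.elim0
  · obtain ⟨n, hn, hdn, h⟩ := hinf N
    exact ⟨n, hn, hdn, ((ncard_rayOrbit_succ_eq_iff L ξ n).mpr h).ge⟩

/-- The conjugating tree automorphism maps one thin subtree onto the other, so the sizes of the
levels are an invariant of the class. -/
theorem ncard_rayOrbit_eq_of_treeClass (hG : IsBranch G) {L L' : Subgroup (TreeAut d)}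
    {ξ ξ' : Boundary d} (hC : IsThinSubtree G (rayOrbit L ξ))
    (hC' : IsThinSubtree G (rayOrbit L' ξ'))
    (h : treeClass G (setStabilizer G (rayOrbit L ξ))
      = treeClass G (setStabilizer G (rayOrbit L' ξ'))) (n : ℕ) :
    (rayOrbit L ξ n).ncard = (rayOrbit L' ξ' n).ncard := by
  obtain ⟨f, hf⟩ := hC.mem_iff_of_treeClass hG hC' (h ▸ mem_treeClass_self _)
  have : f.level n '' rayOrbit L ξ n = rayOrbit L' ξ' n := by
    ext v
    constructor
    · rintro ⟨u, hu, rfl⟩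
      exact (hf n u).mp hu
    · intro hv
      refine ⟨(f⁻¹).level n v, (hf n _).mpr ?_, level_level_inv f n v⟩
      rwa [level_level_inv]
  rw [← this, Set.ncard_image_of_injective _ (f.level n).injective]

/-- A tower of elements that all move the ray provides uncountably many classes of weakly maximal
subgroups up to conjugation in `Aut T`. -/
theorem IsRootedTower.not_countable_treeClass (hd : ∀ n, 2 ≤ d n) (hG : IsBranch G)
    {ξ : Boundary d} {k n : ℕ → ℕ} {h : ℕ → TreeAut d} (H : IsRootedTower G ξ k n h)
    (hmove : ∀ i, h i ∉ vertexStabilizer (ξ.take (n i + 1)))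
    (hinf : ∀ N, ∃ l, N ≤ l ∧ ∀ i, l ≠ n i) :
    ¬ Set.Countable {c : Set (Subgroup G) |
      (∃ W : Subgroup G, IsWeaklyMaximal W ∧ c = treeClass G W) ∧
      ∀ ξ : Boundary d, c ≠ treeClass G (parabolic G ξ)} := by
  classical
  have hd1 : ∀ n, 1 ≤ d n := fun n => one_le_two.trans (hd n)
  -- Replacing entries by 1 preserves the tower axioms, so every set `A` gives its own tower along
  -- the same ray.
  let h' : Set ℕ → ℕ → TreeAut d := fun A i => if i ∈ A then h i else 1
  have H' : ∀ A, IsRootedTower G ξ k n (h' A) := by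
    refine fun A => ⟨H.start_zero, H.start_le, H.start_succ, fun i => ?_, fun i => ?_,
      fun i s => ?_⟩ <;> by_cases hi : i ∈ A
    · simpa [h', hi] using H.mem_rist i
    · simp [h', hi]
    · simpa [h', hi] using H.level_eq i
    · simp [h', hi, level_one]
    · simpa [h', hi] using H.rooted i s
    · simp [h', hi, level_one]
  let L : Set ℕ → Subgroup (TreeAut d) := fun A => tailGroup (h' A) 0
  have hL : ∀ A, IsThinSubtree G (rayOrbit (L A) ξ) := by
    refine fun A => isThinSubtree_rayOrbit hd1
      (((H' A).tailGroup_le_rist 0).trans fun x hx => hx.1) ξ fun N => ?_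
    obtain ⟨l, hl, hln⟩ := hinf N
    exact ⟨l, hl, hd l, fun g hg hgl =>
      (H' A).mem_vertexStabilizer_succ (fun i hi => absurd hi (hln i)) hg hgl⟩
  have hmem : ∀ A i, i ∉ A ↔
      (rayOrbit (L A) ξ (n i)).ncard = (rayOrbit (L A) ξ (n i + 1)).ncard := by
    intro A i
    rw [ncard_rayOrbit_succ_eq_iff]
    constructor
    · intro hi g hg hgl
      refine (H' A).mem_vertexStabilizer_succ (fun j hj => ?_) hg hgl
      have hij : i = j := by
        by_contra hij
        have hlt : StrictMono n := strictMono_nat_of_lt_succ fun a => by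
          have := H.start_le (a + 1)
          rw [H.start_succ] at this
          omega
        exact hij (hlt.injective hj)
      subst hij
      simp [h', hi]
    · intro hstab hi
      have := hstab (h' A i) (Subgroup.subset_closure ⟨i, Nat.zero_le _, rfl⟩)
        ((H' A).level_eq i)
      simp only [h', hi, if_true] at this
      exact hmove i this
  let F : Set ℕ → Set (Subgroup G) := fun A => treeClass G (setStabilizer G (rayOrbit (L A) ξ))
  have hF : Function.Injective F := by
    intro A B hAB
    have hcard := ncard_rayOrbit_eq_of_treeClass hG (hL A) (hL B) hAB
    ext i
    rw [← not_iff_not, hmem, hmem, hcard, hcard]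
  have hbot : ∀ η : Boundary d, IsThinSubtree G (rayOrbit ⊥ η) := fun η =>
    isThinSubtree_rayOrbit hd1 bot_le η fun N => ⟨N, le_rfl, hd N, fun g hg _ => by
      rw [Subgroup.mem_bot.mp hg]
      exact Subgroup.one_mem _⟩
  intro hcount
  -- A nonempty `A` forces growth at some level, whereas the orbit tree of a parabolic subgroup
  -- never grows.
  have hsub : Set.MapsTo F {∅}ᶜ {c : Set (Subgroup G) |
      (∃ W : Subgroup G, IsWeaklyMaximal W ∧ c = treeClass G W) ∧
      ∀ ξ : Boundary d, c ≠ treeClass G (parabolic G ξ)} := by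
    intro A hA
    refine ⟨⟨_, (hL A).isWeaklyMaximal hG, rfl⟩, fun η hη => ?_⟩
    obtain ⟨i, hi⟩ := Set.nonempty_iff_ne_empty.mpr hA
    rw [parabolic_eq_setStabilizer] at hη
    have hcard := ncard_rayOrbit_eq_of_treeClass hG (hL A) (hbot η) hη
    refine (hmem A i).mpr ?_ hi
    rw [hcard, hcard, ncard_rayOrbit_succ_eq_iff]
    intro g hg _
    rw [Subgroup.mem_bot.mp hg]
    exact Subgroup.one_mem _
  have h1 : ({∅}ᶜ : Set (Set ℕ)).Countable :=
    hsub.countable_of_injOn hF.injOn hcount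
  have h2 : (Set.univ : Set (Set ℕ)).Countable := by
    rw [← Set.compl_union_self {∅}]
    exact h1.union (Set.countable_singleton _)
  exact not_countable_of_injective_set Function.injective_id (Set.countable_univ_iff.mp h2)

/-! ### Cyclic rotations and powers of portraits -/

theorem orderOf_finRotate {n : ℕ} (hn : 2 ≤ n) : orderOf (finRotate n) = n := by
  rw [(isCycle_finRotate_of_le hn).orderOf, support_finRotate_of_le hn, Finset.card_univ,
    Fintype.card_fin]

/-- The group generated by a full cycle acts freely. -/
theorem finRotate_zpow_eq_one_of_fixed {n : ℕ} (hn : 2 ≤ n) {z : ℤ} {x : Fin n}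
    (h : (finRotate n ^ z) x = x) : finRotate n ^ z = 1 := by
  have hpos : (0 : ℤ) < orderOf (finRotate n) := by
    rw [orderOf_finRotate hn]
    omega
  obtain ⟨m, hm⟩ := Int.eq_ofNat_of_zero_le (Int.emod_nonneg z hpos.ne')
  rw [← zpow_mod_orderOf, hm, zpow_natCast] at h ⊢
  refine ((isCycle_finRotate_of_le hn).pow_eq_one_iff' (x := x) ?_).mpr h
  rw [← Equiv.Perm.mem_support, support_finRotate_of_le hn]
  exact Finset.mem_univ x

theorem finRotate_zpow_eq_one_iff {n : ℕ} (hn : 2 ≤ n) {z : ℤ} :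
    finRotate n ^ z = 1 ↔ (n : ℤ) ∣ z := by
  rw [← orderOf_dvd_iff_zpow_eq_one, orderOf_finRotate hn]

theorem ofPortrait_level {d : ℕ → ℕ} (l : (n : ℕ) → Vertex d n → Equiv.Perm (Fin (d n)))
    (n : ℕ) (v : Vertex d n) : (ofPortrait l).level n v = portraitMap l n v := rfl

/-- When labels are constant along orbits, iteration multiplies a label only by itself. -/
theorem ofPortrait_pow {d : ℕ → ℕ} {l : (n : ℕ) → Vertex d n → Equiv.Perm (Fin (d n))}
    (hl : ∀ n v, l n (portraitMap l n v) = l n v) (s : ℕ) :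
    ofPortrait l ^ s = ofPortrait fun n u => l n u ^ s := by
  induction s with
  | zero => exact treeAut_ext fun n v => rfl
  | succ s ih =>
    refine treeAut_ext fun n v => funext fun i => ?_
    rw [pow_succ, ih, level_mul, ofPortrait_level, ofPortrait_level, ofPortrait_level]
    change (l i (portraitMap l i (Vertex.take i.2.le v)) ^ s) (l i _ (v i))
      = (l i (Vertex.take i.2.le v) ^ (s + 1)) (v i)
    rw [hl, pow_succ]
    rfl

/-! ### Growing GGS-groups -/

variable {p : ℕ} {m : ℕ → ℕ} {e : Fin (p ^ m 0 - 1) → ℤ}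

theorem two_le_growingDeg (hp : p.Prime) (h0 : 0 < m 0) (hm : StrictMono m) (n : ℕ) :
    2 ≤ growingDeg p m n := by
  have h1 : m n ≠ 0 := (h0.trans_le (hm.monotone (Nat.zero_le n))).ne'
  exact hp.two_le.trans (Nat.le_self_pow h1 p)

theorem ggsA_pow_growingDeg (hd : ∀ n, 2 ≤ growingDeg p m n) :
    ggsA p m ^ growingDeg p m 0 = 1 := by
  unfold ggsA
  rw [ofPortrait_pow (by rintro (_ | n) v <;> rfl)]
  refine treeAut_ext fun n v => funext fun i => ?_
  rw [ofPortrait_level, level_one]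
  obtain ⟨i, hi⟩ := i
  cases i with
  | zero =>
    change (finRotate (growingDeg p m 0) ^ growingDeg p m 0) (v ⟨0, hi⟩) = v ⟨0, hi⟩
    have : finRotate (growingDeg p m 0) ^ growingDeg p m 0 = 1 := by
      have h := pow_orderOf_eq_one (finRotate (growingDeg p m 0))
      rwa [orderOf_finRotate (hd 0)] at h
    rw [this]
    rfl
  | succ i =>
    change ((1 : Equiv.Perm (Fin (growingDeg p m (i + 1)))) ^ growingDeg p m 0) (v ⟨i + 1, hi⟩)
      = v ⟨i + 1, hi⟩
    rw [one_pow]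
    rfl

theorem finite_zpowers_ggsA (hd : ∀ n, 2 ≤ growingDeg p m n) :
    Finite (Subgroup.zpowers (ggsA p m)) :=
  isOfFinOrder_iff_pow_eq_one.mpr
    ⟨_, two_pos.trans_le (hd 0), ggsA_pow_growingDeg hd⟩ |>.finite_zpowers

theorem not_fixes_ggsA (hd : ∀ n, 2 ≤ growingDeg p m n) (ξ : Boundary (growingDeg p m)) :
    ¬ Fixes (ggsA p m) ξ := by
  intro h
  have h1 : finRotate (growingDeg p m 0) (ξ 0) = ξ 0 := congrFun (h 1) 0
  rw [← zpow_one (finRotate _)] at h1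
  have h2 := (finRotate_zpow_eq_one_iff (hd 0)).mp (finRotate_zpow_eq_one_of_fixed (hd 0) h1)
  have h3 := Int.le_of_dvd one_pos h2
  have := hd 0
  omega

theorem ggsBLabel_eq_zpow (n : ℕ) (u : Vertex (growingDeg p m) n) :
    ∃ z : ℤ, ggsBLabel p m e n u = finRotate (growingDeg p m n) ^ z := by
  cases n with
  | zero => exact ⟨0, rfl⟩
  | succ n =>
    rw [ggsBLabel]
    split_ifs
    · exact ⟨_, rfl⟩
    · exact ⟨0, rfl⟩

/-- A nontrivial label needs a last letter below `p ^ m 0 - 1`, which is at most the greatest letter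
of any level. -/
theorem ggsBLabel_eq_one_of_last (hp : p.Prime) (hm : StrictMono m) {n : ℕ}
    (u : Vertex (growingDeg p m) n)
    (h : ∀ i : Fin n, (i : ℕ) + 1 = n → (u i : ℕ) + 1 = growingDeg p m i) :
    ggsBLabel p m e n u = 1 := by
  cases n with
  | zero => rfl
  | succ n =>
    rw [ggsBLabel, dif_neg]
    rintro ⟨h1, -⟩
    have h2 : (u (Fin.last n) : ℕ) + 1 = p ^ m n := h (Fin.last n) rfl
    have h3 : p ^ m 0 ≤ p ^ m n :=
      Nat.pow_le_pow_right hp.pos (hm.monotone (Nat.zero_le n))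
    omega

theorem ggsBLabel_eq_one_of_not_last {n : ℕ} (u : Vertex (growingDeg p m) n) (i : Fin n)
    (hi : (i : ℕ) + 1 < n) (h : (u i : ℕ) + 1 ≠ growingDeg p m i) :
    ggsBLabel p m e n u = 1 := by
  cases n with
  | zero => rfl
  | succ n =>
    rw [ggsBLabel, dif_neg]
    rintro ⟨-, h1⟩
    exact h (h1 ⟨i, by omega⟩)

theorem portraitMap_ggsBLabel_of_last (hp : p.Prime) (hm : StrictMono m) (s : ℕ) {n : ℕ}
    (u : Vertex (growingDeg p m) n)
    (h : ∀ i : Fin n, (i : ℕ) + 1 < n → (u i : ℕ) + 1 = growingDeg p m i) :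
    portraitMap (fun n u => ggsBLabel p m e n u ^ s) n u = u := by
  funext i
  change (ggsBLabel p m e i (Vertex.take i.2.le u) ^ s) (u i) = u i
  rw [ggsBLabel_eq_one_of_last hp hm, one_pow]
  · rfl
  · intro j hj
    exact h (Fin.castLE i.2.le j) (by
      have := i.2
      simp only [Fin.val_castLE]
      omega)

/-- Vertices with a nontrivial label are fixed by `b`, because labels along the path of greatest
letters are trivial. This is the invariance required by `ofPortrait_pow`. -/
theorem ggsBLabel_portraitMap (hp : p.Prime) (hm : StrictMono m) (n : ℕ)
    (v : Vertex (growingDeg p m) n) :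
    ggsBLabel p m e n (portraitMap (ggsBLabel p m e) n v) = ggsBLabel p m e n v := by
  have key : ∀ u : Vertex (growingDeg p m) n, ggsBLabel p m e n u ≠ 1 →
      portraitMap (ggsBLabel p m e) n u = u := by
    intro u hu
    have := portraitMap_ggsBLabel_of_last (e := e) hp hm 1 u fun i hi => by
      by_contra h
      exact hu (ggsBLabel_eq_one_of_not_last u i hi h)
    simpa only [pow_one] using this
  by_cases h1 : ggsBLabel p m e n v = 1
  · by_cases h2 : ggsBLabel p m e n (portraitMap (ggsBLabel p m e) n v) = 1
    · rw [h1, h2]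
    · rw [portraitMap_injective _ n (key _ h2)]
  · rw [key v h1]

theorem ggsB_pow_level (hp : p.Prime) (hm : StrictMono m) (s n : ℕ)
    (v : Vertex (growingDeg p m) n) :
    (ggsB p m e ^ s).level n v = portraitMap (fun n u => ggsBLabel p m e n u ^ s) n v := by
  rw [ggsB, ofPortrait_pow (ggsBLabel_portraitMap hp hm), ofPortrait_level]

theorem ggsBLabel_pow_eq_one (hp : p.Prime) (h0 : 0 < m 0) (hm : StrictMono m) {k n : ℕ}
    (hnk : n ≤ k) (u : Vertex (growingDeg p m) n) : ggsBLabel p m e n u ^ p ^ m k = 1 := by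
  obtain ⟨z, hz⟩ := ggsBLabel_eq_zpow (e := e) n u
  rw [hz, ← zpow_natCast, ← zpow_mul, finRotate_zpow_eq_one_iff (two_le_growingDeg hp h0 hm n)]
  refine Dvd.dvd.mul_left ?_ z
  exact Int.natCast_dvd_natCast.mpr (pow_dvd_pow p (hm.monotone hnk))

/-- A vertex whose letters but the last one are the greatest ones, with last letter `x`. -/
def spineVertex (D : ℕ → ℕ) (hD : ∀ n, 2 ≤ D n) (n : ℕ) (x : Fin (D n)) : Vertex D (n + 1) :=
  Fin.snoc (α := fun i : Fin (n + 1) => Fin (D i))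
    (fun i : Fin n => (⟨D i - 1, by have := hD i; omega⟩ : Fin (D i))) x

theorem spineVertex_castSucc {D : ℕ → ℕ} (hD : ∀ n, 2 ≤ D n) {n : ℕ} (x : Fin (D n))
    (i : Fin n) : (spineVertex D hD n x i.castSucc : ℕ) + 1 = D i := by
  have := hD i
  rw [spineVertex, Fin.snoc_castSucc]
  simp only
  omega

theorem spineVertex_last {D : ℕ → ℕ} (hD : ∀ n, 2 ≤ D n) {n : ℕ} (x : Fin (D n)) :
    spineVertex D hD n x (Fin.last n) = x := by
  rw [spineVertex, Fin.snoc_last]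

theorem spineVertex_of_lt {D : ℕ → ℕ} (hD : ∀ n, 2 ≤ D n) {n : ℕ} (x : Fin (D n))
    (i : Fin (n + 1)) (hi : (i : ℕ) + 1 < n + 1) :
    (spineVertex D hD n x i : ℕ) + 1 = D i :=
  spineVertex_castSucc hD x ⟨i, by omega⟩

/-- The power `b ^ p ^ m k` is supported below the vertex `v` of level `k` all of whose letters are
the greatest ones. -/
theorem ggsB_pow_mem_rist (hp : p.Prime) (h0 : 0 < m 0) (hm : StrictMono m) {k : ℕ}
    (v : Vertex (growingDeg p m) k) (hv : ∀ i, (v i : ℕ) + 1 = growingDeg p m i) :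
    ggsB p m e ^ p ^ m k ∈ rist (growingGGS p m e) v := by
  refine ⟨Subgroup.pow_mem _ (Subgroup.subset_closure (by simp)) _, fun l u hu => ?_⟩
  rw [ggsB_pow_level hp hm]
  funext i
  change (ggsBLabel p m e i (Vertex.take i.2.le u) ^ p ^ m k) (u i) = u i
  suffices h : ggsBLabel p m e i (Vertex.take i.2.le u) ^ p ^ m k = 1 by
    rw [h]
    rfl
  rcases le_or_gt (i : ℕ) k with hik | hik
  · exact ggsBLabel_pow_eq_one hp h0 hm hik _
  · have hkl : k ≤ l := by
      have := i.2
      omega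
    obtain ⟨j, hj⟩ : ∃ j : Fin k, u (Fin.castLE hkl j) ≠ v j := by
      by_contra! h
      exact hu ⟨hkl, funext h⟩
    rw [ggsBLabel_eq_one_of_not_last (i := ⟨j, j.2.trans hik⟩), one_pow]
    · have := j.2
      simp only
      omega
    · intro h
      have h1 : (u (Fin.castLE hkl j) : ℕ) + 1 = growingDeg p m j := h
      have h2 := hv j
      exact hj (Fin.ext (by omega))

/-- Below the vertex `w` of level `n + 1`, powers of `b` change only the letter after `w`. -/
theorem ggsB_pow_below (hp : p.Prime) (hm : StrictMono m) {n s : ℕ}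
    {w : Vertex (growingDeg p m) (n + 1)}
    (hw : ∀ i : Fin (n + 1), (i : ℕ) + 1 < n + 1 → (w i : ℕ) + 1 = growingDeg p m i)
    (hwn : (w (Fin.last n) : ℕ) + 1 ≠ growingDeg p m n)
    (hs : ggsBLabel p m e (n + 1) w ^ s = 1) {l : ℕ} (u : Vertex (growingDeg p m) l)
    (hu : IsPrefix w u) : (ggsB p m e ^ s).level l u = u := by
  obtain ⟨hl, rfl⟩ := hu
  rw [ggsB_pow_level hp hm]
  funext i
  change (ggsBLabel p m e i (Vertex.take i.2.le u) ^ s) (u i) = u i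
  suffices h : ggsBLabel p m e i (Vertex.take i.2.le u) ^ s = 1 by
    rw [h]
    rfl
  rcases lt_trichotomy (i : ℕ) (n + 1) with hi | hi | hi
  · rw [ggsBLabel_eq_one_of_last hp hm, one_pow]
    intro j hj
    exact hw ⟨j, by omega⟩ (by simp only; omega)
  · obtain ⟨i, hil⟩ := i
    simp only at hi
    subst hi
    exact hs
  · rw [ggsBLabel_eq_one_of_not_last (i := ⟨n, by omega⟩), one_pow]
    · exact hi
    · exact hwn

/-- For each `k`, some conjugate of a power of `b` is supported below the `k`-th vertex of the ray,
and is rooted and nontrivial at the vertex of level `k + m 1`. -/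
theorem exists_rooted_ggs (hp : p.Prime) (h0 : 0 < m 0) (hm : StrictMono m)
    (he : ∀ k, |e k| ≤ (p : ℤ) ^ m 1 - 1) (hne : ∃ k, e k ≠ 0)
    (hG : SphericallyTransitive (growingGGS p m e)) (ξ : Boundary (growingDeg p m)) (k : ℕ) :
    ∃ h ∈ rist (growingGGS p m e) (ξ.take k),
      h ∈ vertexStabilizer (ξ.take (k + m 1)) ∧
      h ∉ vertexStabilizer (ξ.take (k + m 1 + 1)) ∧
      ∀ s : ℕ, h ^ s ∈ vertexStabilizer (ξ.take (k + m 1 + 1)) →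
        ∀ l (v : Vertex (growingDeg p m) l), IsPrefix (ξ.take (k + m 1)) v →
          (h ^ s).level l v = v := by
  obtain ⟨x, hx⟩ := hne
  have hD := two_le_growingDeg hp h0 hm
  have hm1 : 0 < m 1 := h0.trans (hm one_pos)
  obtain ⟨n, hn⟩ : ∃ n, k + m 1 = n + 1 := ⟨k + m 1 - 1, by omega⟩
  rw [hn]
  have hxn : (x : ℕ) + 1 < growingDeg p m n := by
    have h1 : p ^ m 0 ≤ p ^ m n := Nat.pow_le_pow_right hp.pos (hm.monotone (Nat.zero_le n))
    have := x.2
    change _ < p ^ m n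
    omega
  -- `w` hangs off the path of greatest letters by the letter `x` with `e x ≠ 0`, so the label of
  -- `b` at `w` is the rotation to the power `e x`, and below `w` nothing but the next letter is
  -- affected.
  set w := spineVertex (growingDeg p m) hD n ⟨x, by omega⟩ with hw
  have hwl : ∀ i : Fin (n + 1), (i : ℕ) + 1 < n + 1 → (w i : ℕ) + 1 = growingDeg p m i :=
    fun i hi => spineVertex_of_lt hD _ i hi
  have hwx : (w (Fin.last n) : ℕ) = x := by rw [hw, spineVertex_last]
  have hlab : ggsBLabel p m e (n + 1) w = finRotate (growingDeg p m (n + 1)) ^ e x := by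
    rw [ggsBLabel, dif_pos ⟨by rw [hwx]; exact x.2, fun i => spineVertex_castSucc hD _ i⟩]
    congr 2
    exact Fin.ext hwx
  have hkn : k ≤ n + 1 := by omega
  have hkn' : k < n + 1 := by omega
  obtain ⟨g, hg, hgw⟩ := hG (n + 1) w (ξ.take (n + 1))
  have hgk : g.level k (Vertex.take hkn w) = ξ.take k := by
    rw [← take_level, hgw]
    rfl
  -- This exponent kills all labels up to level `k`, so `c` is supported below a single vertex of
  -- level `k`; conjugation by `g` moves `w` onto the ray.
  set c := ggsB p m e ^ p ^ m k with hc
  have hcw : ∀ s : ℕ, (c ^ s).level (n + 1) w = w := by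
    intro s
    rw [hc, ← pow_mul, ggsB_pow_level hp hm]
    exact portraitMap_ggsBLabel_of_last hp hm _ w hwl
  have hroot : ∀ s : ℕ, ∀ u : Vertex (growingDeg p m) (n + 2), IsPrefix w u →
      (c ^ s).level (n + 2) u = u →
      finRotate (growingDeg p m (n + 1)) ^ (e x * (p ^ m k * s)) = 1 := by
    rintro s u ⟨hl, hu⟩ hcu
    rw [hc, ← pow_mul, ggsB_pow_level hp hm] at hcu
    have h1 : (ggsBLabel p m e (n + 1) (Vertex.take hl u) ^ (p ^ m k * s)) (u (Fin.last (n + 1)))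
        = u (Fin.last (n + 1)) := congrFun hcu (Fin.last (n + 1))
    rw [hu, hlab, ← zpow_natCast, ← zpow_mul] at h1
    have h2 := finRotate_zpow_eq_one_of_fixed (hD (n + 1)) h1
    push_cast at h2
    exact h2
  have hconj : ∀ s l (v : Vertex (growingDeg p m) l),
      ((g * c * g⁻¹) ^ s).level l v = g.level l ((c ^ s).level l ((g⁻¹).level l v)) := by
    intro s l v
    rw [conj_pow]
    rfl
  have hpre : ∀ {l} {v : Vertex (growingDeg p m) l}, IsPrefix (ξ.take (n + 1)) v →
      IsPrefix w ((g⁻¹).level l v) := by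
    intro l v hv
    have := hv.map g⁻¹
    rwa [← hgw, level_inv_level] at this
  have hchild : ∀ s : ℕ, (g * c * g⁻¹) ^ s ∈ vertexStabilizer (ξ.take (n + 1 + 1)) →
      finRotate (growingDeg p m (n + 1)) ^ (e x * (p ^ m k * s)) = 1 := by
    intro s hs
    have h1 := hconj s (n + 2) (ξ.take (n + 2))
    rw [show ((g * c * g⁻¹) ^ s).level (n + 2) (ξ.take (n + 2)) = ξ.take (n + 2) from hs] at h1
    refine hroot s _ (hpre (isPrefix_boundary ξ (Nat.le_succ (n + 1)))) ?_
    conv_rhs => rw [h1, level_inv_level]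
  refine ⟨g * c * g⁻¹, ?_, ?_, fun h => ?_, fun s hs l v hv => ?_⟩
  · rw [← hgk]
    refine rist_conj hg (ggsB_pow_mem_rist hp h0 hm _ fun i => ?_)
    exact hwl (Fin.castLE hkn i) (by
      have := i.2
      simp only [Fin.val_castLE]
      omega)
  · have h1 := hconj 1 (n + 1) (ξ.take (n + 1))
    rw [pow_one, ← hgw, level_inv_level, hcw] at h1
    rw [← hgw]
    exact h1
  · have h1 := hchild 1 (by rwa [pow_one])
    rw [finRotate_zpow_eq_one_iff (hD (n + 1))] at h1
    -- The depth `m 1` is chosen here: strict growth gives `m k + m 1 ≤ m (k + m 1)`, so a trivial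
    -- label of `c` would force `p ^ m 1` to divide `e x`, contradicting the size bound on `e x`.
    have h2 : ((p : ℤ) ^ m k * (p : ℤ) ^ m 1) ∣ (p : ℤ) ^ m k * e x := by
      have h3 : k + m 1 ≤ n + 1 := hn.le
      have h4 : m k + m 1 ≤ m (n + 1) := by
        have h5 : ∀ j, m k + j ≤ m (k + j) := by
          intro j
          induction j with
          | zero => simp
          | succ j ih =>
            have := hm (Nat.lt_succ_self (k + j))
            rw [← add_assoc, ← add_assoc]
            exact Nat.succ_le_of_lt (ih.trans_lt this)
        rw [← hn]
        exact h5 _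
      rw [← pow_add]
      refine (pow_dvd_pow (p : ℤ) h4).trans ?_
      have h6 : ((growingDeg p m (n + 1) : ℕ) : ℤ) = (p : ℤ) ^ m (n + 1) := by
        simp [growingDeg]
      rw [h6] at h1
      rw [mul_comm]
      simpa only [Nat.cast_one, mul_one] using h1
    have hp0 : (p : ℤ) ^ m k ≠ 0 := pow_ne_zero _ (by exact_mod_cast hp.ne_zero)
    have h3 := Int.le_of_dvd (abs_pos.mpr hx) ((dvd_abs _ _).mpr ((mul_dvd_mul_iff_left hp0).mp h2))
    have := he x
    omega
  · have h1 := hchild s hs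
    rw [hconj, hc, ← pow_mul, ggsB_pow_below hp hm hwl (by rw [hwx]; exact hxn.ne) ?_ _ (hpre hv),
      level_level_inv]
    rw [hlab, ← zpow_natCast, ← zpow_mul]
    push_cast
    exact h1

/-- The tower uses consecutive blocks of `m 1 + 1` levels, each with one rooted element acting at
the last level of its block. -/
theorem not_countable_treeClass_ggs (hp : p.Prime) (h0 : 0 < m 0) (hm : StrictMono m)
    (he : ∀ k, |e k| ≤ (p : ℤ) ^ m 1 - 1) (hne : ∃ k, e k ≠ 0)
    (hG : IsBranch (growingGGS p m e)) :
    ¬ Set.Countable {c : Set (Subgroup (growingGGS p m e)) |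
      (∃ W : Subgroup (growingGGS p m e), IsWeaklyMaximal W ∧
        c = treeClass (growingGGS p m e) W) ∧
      ∀ ξ : Boundary (growingDeg p m),
        c ≠ treeClass (growingGGS p m e) (parabolic (growingGGS p m e) ξ)} := by
  have hD := two_le_growingDeg hp h0 hm
  let ξ : Boundary (growingDeg p m) := fun i => ⟨0, two_pos.trans_le (hD i)⟩
  choose h h_rist h_fix h_move h_root using exists_rooted_ggs hp h0 hm he hne hG.1 ξ
  have hm1 : 0 < m 1 := h0.trans (hm one_pos)
  have H : IsRootedTower (growingGGS p m e) ξ (fun i => i * (m 1 + 1))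
      (fun i => i * (m 1 + 1) + m 1) (fun i => h (i * (m 1 + 1))) := by
    refine ⟨by simp, fun i => Nat.le_add_right _ _, fun i => by ring, fun i => h_rist _,
      fun i => h_fix _, fun i s hs l v hv => ?_⟩
    obtain ⟨s, rfl | rfl⟩ := s.eq_nat_or_neg
    · rw [zpow_natCast] at hs ⊢
      exact h_root _ s hs l v hv
    · rw [zpow_neg, zpow_natCast] at hs ⊢
      have h1 := h_root _ s (inv_mem_iff.mp (show _ ∈ vertexStabilizer _ from hs)) l v hv
      exact (vertexStabilizer v).inv_mem h1
  refine H.not_countable_treeClass hD hG (fun i => h_move _) fun N =>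
    -- The first level of a block is never its last, since `m 1 > 0`; such levels add no branching
    -- and make the orbits thin.
    ⟨N * (m 1 + 1), Nat.le_mul_of_pos_right N (Nat.succ_pos _), fun i hi => ?_⟩
  have h1 := congrArg (· % (m 1 + 1)) hi
  simp only [Nat.mul_mod_left, Nat.mul_add_mod', Nat.mod_eq_of_lt (Nat.lt_succ_self (m 1))] at h1
  omega

end BranchTree

theorem mainTheorem8 :
    -- finitely generated branch groups
    (∀ (d : ℕ → ℕ), (∀ n, 1 ≤ d n) → (∀ n, ∃ k, n ≤ k ∧ 2 ≤ d k) →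
      ∀ G : Subgroup (BranchTree.TreeAut d), G.FG → BranchTree.IsBranch G →
      ∀ Q : Subgroup (BranchTree.TreeAut d), Q ≤ G → Finite Q →
        (∀ ξ : BranchTree.Boundary d, ∃ q ∈ Q, ¬ BranchTree.Fixes q ξ) →
        ¬ Set.Countable {c : Set (Subgroup G) |
            (∃ W : Subgroup G, BranchTree.IsWeaklyMaximal W ∧ c = BranchTree.autClass W) ∧
            ∀ ξ : BranchTree.Boundary d,
              c ≠ BranchTree.autClass (BranchTree.parabolic G ξ)}) ∧
    -- branch growing GGS-groups, with `Q` generated by `a`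
    (∀ (p : ℕ) (m : ℕ → ℕ) (e : Fin (p ^ m 0 - 1) → ℤ),
      p.Prime → p ≠ 2 → 0 < m 0 → StrictMono m →
      (∀ k, |e k| ≤ (p : ℤ) ^ m 1 - 1) → (∃ k, e k ≠ 0) →
      BranchTree.IsBranch (BranchTree.growingGGS p m e) →
        (BranchTree.growingGGS p m e).FG ∧
        Subgroup.zpowers (BranchTree.ggsA p m) ≤ BranchTree.growingGGS p m e ∧
        Finite (Subgroup.zpowers (BranchTree.ggsA p m)) ∧
        (∀ ξ : BranchTree.Boundary (BranchTree.growingDeg p m),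
          ∃ q ∈ Subgroup.zpowers (BranchTree.ggsA p m), ¬ BranchTree.Fixes q ξ) ∧
        ¬ Set.Countable {c : Set (Subgroup (BranchTree.growingGGS p m e)) |
            (∃ W : Subgroup (BranchTree.growingGGS p m e),
              BranchTree.IsWeaklyMaximal W ∧ c = BranchTree.autClass W) ∧
            ∀ ξ : BranchTree.Boundary (BranchTree.growingDeg p m),
              c ≠ BranchTree.autClass (BranchTree.parabolic (BranchTree.growingGGS p m e) ξ)} ∧
        ¬ Set.Countable {c : Set (Subgroup (BranchTree.growingGGS p m e)) |
            (∃ W : Subgroup (BranchTree.growingGGS p m e),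
              BranchTree.IsWeaklyMaximal W ∧
              c = BranchTree.treeClass (BranchTree.growingGGS p m e) W) ∧
            ∀ ξ : BranchTree.Boundary (BranchTree.growingDeg p m),
              c ≠ BranchTree.treeClass (BranchTree.growingGGS p m e)
                (BranchTree.parabolic (BranchTree.growingGGS p m e) ξ)}) := by
  refine ⟨fun d hd hd2 G hfg hG Q hQG hfin hQ => ?_, fun p m e hp _ h0 hm he hne hG => ?_⟩
  · exact BranchTree.not_countable_autClass hd hd2 hfg hG Q hQG hQ
  · have hD := BranchTree.two_le_growingDeg hp h0 hm
    have hfg : (BranchTree.growingGGS p m e).FG :=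
      (Subgroup.fg_iff _).mpr ⟨{BranchTree.ggsA p m, BranchTree.ggsB p m e}, rfl, Set.toFinite _⟩
    have hle : Subgroup.zpowers (BranchTree.ggsA p m) ≤ BranchTree.growingGGS p m e :=
      (Subgroup.zpowers_le).mpr (Subgroup.subset_closure (Set.mem_insert _ _))
    have hfin := BranchTree.finite_zpowers_ggsA hD
    have hQ : ∀ ξ : BranchTree.Boundary (BranchTree.growingDeg p m),
        ∃ q ∈ Subgroup.zpowers (BranchTree.ggsA p m), ¬ BranchTree.Fixes q ξ := fun ξ =>
      ⟨_, Subgroup.mem_zpowers _, BranchTree.not_fixes_ggsA hD ξ⟩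
    exact ⟨hfg, hle, hfin, hQ,
      BranchTree.not_countable_autClass (fun n => one_le_two.trans (hD n))
        (fun n => ⟨n, le_rfl, hD n⟩) hfg hG _ hle hQ,
      BranchTree.not_countable_treeClass_ggs hp h0 hm he hne hG⟩
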